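/- All algebras are complex and nonzero. For a unital $C^*$-algebra $\mathcal A$ let $\mathcal C(\mathcal A)$ be the set of abelian $C^*$-subalgebras of $\mathcal A$ containing the unit of $\mathcal A$ (including $\mathbb C1$), ordered by inclusion. The spectral presheaf $\underline\Sigma^{\mathcal A}$ is the presheaf on $\mathcal C(\mathcal A)$ with values in compact Hausdorff spaces that sends $C$ to its Gelfand spectrum $\Sigma(C)$ and an inclusion $C'\subseteq C$ to the restriction $\lambda\mapsto\lambda|_{C'}$. The Bohrification $\overline{\mathcal A}$ is the copresheaf of unital abelian $C^*$-algebras $C\mapsto C$ on $\mathcal C(\mathcal A)$, with the inclusions as maps. An isomorphism $\langle\Gamma,\iota\rangle:\underline\Sigma^{\mathcal B}\to\underline\Sigma^{\mathcal A}$ consists of an order-isomorphism $\gamma:\mathcal C(\mathcal A)\to\mathcal C(\mathcal B)$ (its base map, inducing the geometric isomorphism $\Gamma$) and a natural family of homeomorphisms $\iota_C:\Sigma(\gamma(C))\to\Sigma(C)$. An isomorphism $\langle\tilde\Gamma,\kappa\rangle:\overline{\mathcal A}\to\overline{\mathcal B}$ consists of an order-isomorphism $\gamma:\mathcal C(\mathcal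 A)\to\mathcal C(\mathcal B)$ (its base map) and a natural family of unital $*$-isomorphisms $\kappa_C:C\to\gamma(C)$. A quasi-Jordan isomorphism is a bijection $Q:\mathcal A_{\mathrm{sa}}\to\mathcal B_{\mathrm{sa}}$ between the self-adjoint parts such that $Q$ and $Q^{-1}$ are unital and restrict, on the self-adjoint part of every abelian $C^*$-subalgebra containing the unit, to real-linear maps preserving the Jordan product $\frac12(ab+ba)$. Let $\mathcal A_{\mathrm{part}}$ be the set of normal elements of $\mathcal A$; an isomorphism of partial unital $C^*$-algebras is a bijection $T:\mathcal A_{\mathrm{part}}\to\mathcal B_{\mathrm{part}}$ such that $T$ and $T^{-1}$ preserve the unit, the involution, and complex linear combinations and products of commuting elements. **Theorem.** Let $\mathcal A,\mathcal B$ be nonzero unital $C^*$-algebras, neither of them isomorphic to $\mathbb C^2$ or to $\mathcal B(\mathbb C^2)$. Then: 1. There is a bijective correspondence between isomorphisms $\langle\Gamma,\iota\rangle:\underline\Sigma^{\mathcal B}\to\underline\Sigma^{\mathcal A}$ and quasi-Jordan isomorphisms $Q:\mathcal A_{\mathrm{sa}}\to\mathcal B_{\mathrm{sa}}$, where $\langle\Gamma,\iota\rangle$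 with base map $\gamma$ corresponds to $Q$ if and only if for all $C\in\mathcal C(\mathcal A)$ and $a\in C_{\mathrm{sa}}$ one has $Q(a)\in\gamma(C)$ and $\iota_C(\lambda)(a)=\lambda(Q(a))$ for all $\lambda\in\Sigma(\gamma(C))$. 2. There is a bijective correspondence between isomorphisms of partial unital $C^*$-algebras $T:\mathcal A_{\mathrm{part}}\to\mathcal B_{\mathrm{part}}$ and quasi-Jordan isomorphisms $Q$, where $T$ corresponds to $Q$ if and only if $T|_{\mathcal A_{\mathrm{sa}}}=Q$. 3. There is a bijective correspondence between isomorphisms $\langle\tilde\Gamma,\kappa\rangle:\overline{\mathcal A}\to\overline{\mathcal B}$ and quasi-Jordan isomorphisms $Q$, where $\langle\tilde\Gamma,\kappa\rangle$ corresponds to $Q$ if and only if $\kappa_C(a)=Q(a)$ for all $C\in\mathcal C(\mathcal A)$ and $a\in C_{\mathrm{sa}}$. 4. There is a bijective correspondence between order-isomorphisms $\gamma:\mathcal C(\mathcal A)\to\mathcal C(\mathcal B)$ and quasi-Jordan isomorphisms $Q$, where $\gamma$ corresponds to $Q$ if and only if $\gamma(C)_{\mathrm{sa}}=Q(C_{\mathrm{sa}})$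 for all $C\in\mathcal C(\mathcal A)$. 5. If $\langle\Gamma,\iota\rangle$ (respectively $\langle\tilde\Gamma,\kappa\rangle$) corresponds to $Q$, then the order-isomorphism corresponding to $Q$ is its base map. Every order-isomorphism $\gamma:\mathcal C(\mathcal A)\to\mathcal C(\mathcal B)$ is the base map of exactly one isomorphism $\underline\Sigma^{\mathcal B}\to\underline\Sigma^{\mathcal A}$ and of exactly one isomorphism $\overline{\mathcal A}\to\overline{\mathcal B}$. -/

import Mathlib

open CategoryTheory Opposite

universe u v w

noncomputable section

/-! ### Presheaves and copresheaves over varying posets -/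

section Presheaves

variable {D : Type w} [Category.{v} D] {J K : Type u} [PartialOrder J] [PartialOrder K]

/-- The inverse image part `Γ^*`, on presheaves, of the essential geometric isomorphism induced by
an order-isomorphism `γ : J → K`: precomposition with `γ`, so `(Γ^* P)_j = P_{γ j}`. -/
def presheafInverseImage (γ : J ≃o K) : (Kᵒᵖ ⥤ D) ⥤ (Jᵒᵖ ⥤ D) :=
  (Functor.whiskeringLeft _ _ _).obj γ.monotone.functor.op

/-- The inverse image part `Γ^*`, on copresheaves, of the essential geometric isomorphism induced
by an order-isomorphism `γ : J → K`. -/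
def copresheafInverseImage (γ : J ≃o K) : (K ⥤ D) ⥤ (J ⥤ D) :=
  (Functor.whiskeringLeft _ _ _).obj γ.monotone.functor

/-- An isomorphism `⟨Γ, ι⟩ : P → Q` from a presheaf `P` over `K` to a presheaf `Q` over `J`:
a base map, i.e. an order-isomorphism `γ : J → K` (which induces `Γ`), together with a natural
isomorphism `ι : Γ^* P → Q`. -/
structure PresheafIso (P : Kᵒᵖ ⥤ D) (Q : Jᵒᵖ ⥤ D) where
  base : J ≃o K
  iota : (presheafInverseImage base).obj P ≅ Q

/-- An isomorphism `⟨Γ, κ⟩ : P → Q` from a copresheaf `P` over `J` to a copresheaf `Q` over `K`: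
a base map, i.e. an order-isomorphism `γ : J → K` (which induces `Γ`), together with a natural
isomorphism `κ : P → Γ^* Q`. -/
structure CopresheafIso (P : J ⥤ D) (Q : K ⥤ D) where
  base : J ≃o K
  kappa : P ≅ (copresheafInverseImage base).obj Q

end Presheaves

/-! ### The category of unital abelian C*-algebras -/

/-- Unital abelian C*-algebras. -/
structure UCommCStar : Type (u + 1) where
  carrier : Type u
  [str : CommCStarAlgebra carrier]

attribute [instance] UCommCStar.str

/-- Arrows between unital abelian C*-algebras: unital *-homomorphisms. -/
structure UCommCStarHom (X Y : UCommCStar.{u}) : Type u where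
  hom : X.carrier →⋆ₐ[ℂ] Y.carrier

instance : Category.{u} UCommCStar.{u} where
  Hom X Y := UCommCStarHom X Y
  id X := ⟨StarAlgHom.id ℂ X.carrier⟩
  comp f g := ⟨g.hom.comp f.hom⟩

/-! ### Contexts, the spectral presheaf and the Bohrification -/

/-- The context category: the closed (hence C*-) commutative *-subalgebras of `A` containing the
unit of `A`, ordered by inclusion. The trivial subalgebra `ℂ1` is included. -/
def Context (A : Type u) [CStarAlgebra A] : Type u :=
  {C : StarSubalgebra ℂ A // IsClosed (C : Set A) ∧ ∀ x ∈ C, ∀ y ∈ C, x * y = y * x}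

instance (A : Type u) [CStarAlgebra A] : PartialOrder (Context A) :=
  inferInstanceAs (PartialOrder
    {C : StarSubalgebra ℂ A // IsClosed (C : Set A) ∧ ∀ x ∈ C, ∀ y ∈ C, x * y = y * x})

section Constructions

variable {A : Type u} [CStarAlgebra A]

/-- The underlying *-subalgebra of a context. -/
abbrev Context.alg (C : Context A) : StarSubalgebra ℂ A := C.1

instance (C : Context A) : CommCStarAlgebra C.alg :=
  { StarSubalgebra.cstarAlgebra C.alg (h_closed := C.2.1) with
    mul_comm := fun x y => Subtype.ext (C.2.2 x x.2 y y.2) }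

/-- The inclusion of a smaller context into a larger one. -/
def Context.incl {C C' : Context A} (h : C' ≤ C) : C'.alg →⋆ₐ[ℂ] C.alg :=
  StarSubalgebra.inclusion h

variable (A)

/-- The spectral presheaf of `A`: it sends a context to its Gelfand spectrum, and an inclusion of
contexts to the restriction of characters. -/
def spectralPresheaf : (Context A)ᵒᵖ ⥤ CompHaus.{u} where
  obj C := CompHaus.of (WeakDual.characterSpace ℂ C.unop.alg)
  map f := CompHausLike.ofHom _
    (WeakDual.CharacterSpace.compContinuousMap (Context.incl (leOfHom f.unop)))

/-- The Bohrification of `A`: the tautological copresheaf `C ↦ C` over the context category. -/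
def bohrification : Context A ⥤ UCommCStar.{u} where
  obj C := ⟨C.alg⟩
  map f := ⟨Context.incl (leOfHom f)⟩

end Constructions

/-! ### Quasi-Jordan isomorphisms and partial C*-algebras -/

section Algebraic

variable {A B : Type u} [CStarAlgebra A] [CStarAlgebra B]

/-- The Jordan product `(ab + ba) / 2` of self-adjoint elements. -/
def jordanMul (a b : selfAdjoint A) : selfAdjoint A :=
  ⟨(2⁻¹ : ℝ) • ((a : A) * b + b * a), by
    have ha : star (a : A) = a := a.2
    have hb : star (b : A) = b := b.2
    rw [selfAdjoint.mem_iff, star_smul, star_add, star_mul, star_mul, ha, hb, add_comm]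
    simp⟩

/-- A quasi-Jordan homomorphism `A_sa → B_sa`: a unital map whose restriction to the self-adjoint
part of each context is a (real-linear) Jordan homomorphism. -/
structure IsQuasiJordanHom (Q : selfAdjoint A → selfAdjoint B) : Prop where
  map_one : Q 1 = 1
  map_add : ∀ (C : Context A) (a b : selfAdjoint A), (a : A) ∈ C.alg → (b : A) ∈ C.alg →
    Q (a + b) = Q a + Q b
  map_smul : ∀ (C : Context A) (r : ℝ) (a : selfAdjoint A), (a : A) ∈ C.alg →
    Q (r • a) = r • Q a
  map_jordanMul : ∀ (C : Context A) (a b : selfAdjoint A), (a : A) ∈ C.alg → (b : A) ∈ C.alg →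
    Q (jordanMul a b) = jordanMul (Q a) (Q b)

variable (A B) in
/-- Quasi-Jordan isomorphisms: bijections `A_sa → B_sa` that are quasi-Jordan homomorphisms in
both directions. -/
structure QuasiJordanIso where
  toEquiv : selfAdjoint A ≃ selfAdjoint B
  hom : IsQuasiJordanHom toEquiv
  inv : IsQuasiJordanHom toEquiv.symm

variable (A) in
/-- The partial unital C*-algebra of `A`: its normal elements, with involution, unit, and with
linear combinations and products of commuting elements. -/
def PartialCStar : Type u := {a : A // IsStarNormal a}

namespace PartialCStar

instance : One (PartialCStar A) := ⟨⟨1, inferInstance⟩⟩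

instance : Star (PartialCStar A) := ⟨fun a => ⟨star a.1, have := a.2; inferInstance⟩⟩

/-- Self-adjoint elements are normal. -/
def ofSelfAdjoint (a : selfAdjoint A) : PartialCStar A := ⟨a, inferInstance⟩

/-- The linear combination `αx + βy` of commuting normal elements. -/
def linComb (α β : ℂ) (x y : PartialCStar A) (h : Commute x.1 y.1) : PartialCStar A :=
  ⟨α • x.1 + β • y.1, by
    have hx := x.2
    have hy := y.2
    have h₁ : Commute (star x.1) y.1 := hx.commute_star_left h
    have h₂ : Commute x.1 (star y.1) := hy.commute_star_right h
    refine ⟨?_⟩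
    rw [star_add, star_smul, star_smul]
    exact (((hx.star_comm_self.smul_left _).smul_right _).add_right
      ((h₁.smul_left _).smul_right _)).add_left
      (((h₂.symm.smul_left _).smul_right _).add_right
        ((hy.star_comm_self.smul_left _).smul_right _))⟩

/-- The product of commuting normal elements. -/
def mul (x y : PartialCStar A) (h : Commute x.1 y.1) : PartialCStar A :=
  ⟨x.1 * y.1, by
    have hx := x.2
    have hy := y.2
    have h₁ : Commute (star x.1) y.1 := hx.commute_star_left h
    have h₂ : Commute x.1 (star y.1) := hy.commute_star_right h
    refine ⟨?_⟩
    rw [star_mul]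
    exact ((h₂.symm.mul_right hy.star_comm_self).mul_left (hx.star_comm_self.mul_right h₁))⟩

end PartialCStar

/-- A morphism of partial unital C*-algebras: a unital *-preserving map that respects linear
combinations and products of commuting elements. (The last condition makes the images of commuting
elements commute.) -/
structure IsPartialHom (T : PartialCStar A → PartialCStar B) : Prop where
  map_one : T 1 = 1
  map_star : ∀ x, T (star x) = star (T x)
  map_linComb : ∀ (α β : ℂ) (x y : PartialCStar A) (h : Commute x.1 y.1),
    (T (PartialCStar.linComb α β x y h)).1 = α • (T x).1 + β • (T y).1
  map_mul : ∀ (x y : PartialCStar A) (h : Commute x.1 y.1),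
    (T (PartialCStar.mul x y h)).1 = (T x).1 * (T y).1

variable (A B) in
/-- Isomorphisms of partial unital C*-algebras. -/
structure PartialIso where
  toEquiv : PartialCStar A ≃ PartialCStar B
  hom : IsPartialHom toEquiv
  inv : IsPartialHom toEquiv.symm

/-! ### The correspondences -/

/-- The component `ι_C : Σ(γ(C)) → Σ(C)` of an isomorphism of spectral presheaves. -/
def PresheafIso.component (e : PresheafIso (spectralPresheaf B) (spectralPresheaf A))
    (C : Context A) (l : WeakDual.characterSpace ℂ (e.base C).alg) :
    WeakDual.characterSpace ℂ C.alg :=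
  ConcreteCategory.hom (e.iota.hom.app (op C)) l

/-- The component `κ_C : C → γ(C)` of an isomorphism of Bohrifications. -/
def CopresheafIso.component (k : CopresheafIso (bohrification A) (bohrification B))
    (C : Context A) : C.alg →⋆ₐ[ℂ] (k.base C).alg :=
  (k.kappa.hom.app C).hom

/-- `⟨Γ, ι⟩ : Σ^B → Σ^A` corresponds to `Q`: for every context `C`, `Q` maps `C_sa` into `γ(C)`,
and `ι_C(l) = l ∘ Q` on `C_sa` for every character `l` of `γ(C)`. -/
def QuasiJordanIso.CorrSpectral (Q : QuasiJordanIso A B)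
    (e : PresheafIso (spectralPresheaf B) (spectralPresheaf A)) : Prop :=
  ∀ (C : Context A) (a : selfAdjoint A) (ha : (a : A) ∈ C.alg),
    ∃ hb : (Q.toEquiv a : B) ∈ (e.base C).alg,
      ∀ l : WeakDual.characterSpace ℂ (e.base C).alg,
        e.component C l ⟨a, ha⟩ = l ⟨Q.toEquiv a, hb⟩

/-- An isomorphism of Bohrifications corresponds to `Q`: each `κ_C` agrees with `Q` on `C_sa`. -/
def QuasiJordanIso.CorrBohr (Q : QuasiJordanIso A B)
    (k : CopresheafIso (bohrification A) (bohrification B)) : Prop :=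
  ∀ (C : Context A) (a : selfAdjoint A) (ha : (a : A) ∈ C.alg),
    (k.component C ⟨a, ha⟩ : B) = Q.toEquiv a

/-- An isomorphism of partial C*-algebras corresponds to `Q`: it extends `Q`. -/
def QuasiJordanIso.CorrPartial (Q : QuasiJordanIso A B) (T : PartialIso A B) : Prop :=
  ∀ a : selfAdjoint A, T.toEquiv (PartialCStar.ofSelfAdjoint a) =
    PartialCStar.ofSelfAdjoint (Q.toEquiv a)

/-- An order-isomorphism `γ` of context categories corresponds to `Q`: `γ(C)_sa = Q(C_sa)`. -/
def QuasiJordanIso.CorrOrder (Q : QuasiJordanIso A B) (γ : Context A ≃o Context B) : Prop :=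
  ∀ (C : Context A) (a : selfAdjoint A), (Q.toEquiv a : B) ∈ (γ C).alg ↔ (a : A) ∈ C.alg

end Algebraic

/-- The relation `R` is (the graph of) a bijective correspondence. -/
def IsBijectiveCorrespondence {X Y : Type*} (R : X → Y → Prop) : Prop :=
  (∀ x, ∃! y, R x y) ∧ ∀ y, ∃! x, R x y

end

/-! Every isomorphism in the theorem amounts to a family of star-homomorphisms `κ` on contexts,
agreeing on overlaps, that carries each subcontext `D` onto `γ D` (`Implements`). A quasi-Jordan
isomorphism yields such a family: it sends commuting elements to commuting elements
(`IsQuasiJordanHom.commute`), so it is multiplicative on each context and extends complex-linearly.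
Conversely, a cofinal coherent family glues to a quasi-Jordan isomorphism
(`exists_quasiJordanIso_of_implements`). An isomorphism of Bohrifications is such a family, one of
spectral presheaves is its Gelfand dual, and partial isomorphisms are handled by splitting normal
elements into commuting real and imaginary parts.

The hard point is that a bare order-isomorphism `γ` determines `κ`. The coatoms below a context `C`
are the subalgebras on which two distinct characters agree (`covBy_iff`), so `γ` acts on pairs of
points of the spectrum. It preserves triangles, because the meet of two sides lies below the third.
Unless the spectrum has exactly two points, where swapping them goes unnoticed, the action on pairs
comes from a bijection of points (`exists_point_map`). Closed sets are visible through the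
subcontexts `constOn F`, so the bijection is a homeomorphism (`exists_spec_homeo`), and its dual
implements `γ` uniquely on `C`.

Two good contexts may meet in the span of a projection `p` and `1 - p`, where uniqueness fails and
one homomorphism might send `p` to the complement of the other's value. `Implements.eq_projection`
rules this out: the contexts are shrunk until each is scalar on one corner of `p`, and then either
they commute or, in the presence of a flip, their images do. Finally, good contexts are cofinal
outside the two exceptional algebras (`Context.exists_good_ge`): if no good context contains the
span of `p` and `1 - p`, both corners of `p` are one-dimensional, which forces `ℂ²` or `B(ℂ²)`. -/

noncomputable section

/-! ### Characters of commutative C*-algebras -/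

section Gelfand

open WeakDual

variable {X Y : Type u} [CommCStarAlgebra X] [CommCStarAlgebra Y]

theorem gelfand_ext {a b : X} (h : ∀ l : characterSpace ℂ X, l a = l b) : a = b :=
  (gelfandStarTransform X).injective (ContinuousMap.ext h)

theorem exists_gelfand_eq (f : C(characterSpace ℂ X, ℂ)) :
    ∃ a : X, ∀ l : characterSpace ℂ X, l a = f l := by
  obtain ⟨a, ha⟩ := (gelfandStarTransform X).surjective f
  exact ⟨a, fun l => by rw [← ha]; rfl⟩

theorem characterSpace_apply_star (l : characterSpace ℂ X) (a : X) : l (star a) = star (l a) :=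
  map_star l a

theorem exists_zero_one_of_isClosed {S T : Set (characterSpace ℂ X)} (hS : IsClosed S)
    (hT : IsClosed T) (h : Disjoint S T) :
    ∃ a : X, (∀ l ∈ S, l a = 0) ∧ ∀ l ∈ T, l a = 1 := by
  obtain ⟨f, hf0, hf1, -⟩ := exists_continuous_zero_one_of_isClosed hS hT h
  obtain ⟨a, ha⟩ := exists_gelfand_eq
    (⟨fun l => (f l : ℂ), Complex.continuous_ofReal.comp f.continuous⟩ :
      C(characterSpace ℂ X, ℂ))
  refine ⟨a, fun l hl => ?_, fun l hl => ?_⟩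
  · rw [ha]
    simp [hf0 hl]
  · rw [ha]
    simp [hf1 hl]

/-- The range is compact, hence closed. A Urysohn element separating a missed character from it
would be sent by `i` to something killed by all characters, hence would be zero. -/
theorem compContinuousMap_surjective (i : Y →⋆ₐ[ℂ] X) (hi : Function.Injective i) :
    Function.Surjective (CharacterSpace.compContinuousMap i) := by
  intro m
  by_contra hm
  have hc : IsClosed (Set.range (CharacterSpace.compContinuousMap i)) :=
    (isCompact_range (CharacterSpace.compContinuousMap i).continuous).isClosed
  obtain ⟨y, hy0, hy1⟩ := exists_zero_one_of_isClosed hc (isClosed_singleton (x := m))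
    (by simpa using hm)
  have : i y = 0 := gelfand_ext fun l => by
    rw [map_zero]
    exact hy0 _ ⟨l, rfl⟩
  have hy : y = 0 := hi (by rw [this, map_zero])
  have := hy1 m rfl
  rw [hy, map_zero] at this
  exact zero_ne_one this

/-- Stone-Weierstrass for a not necessarily separating C*-subalgebra. -/
theorem mem_range_iff_forall_character (i : Y →⋆ₐ[ℂ] X) (hi : Function.Injective i) (a : X) :
    a ∈ Set.range i ↔
      ∀ l m : characterSpace ℂ X, (∀ y, l (i y) = m (i y)) → l a = m a := by
  constructor
  · rintro ⟨y, rfl⟩ l m h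
    exact h y
  intro h
  -- A closed continuous surjection is a quotient map, so the Gelfand transform of `a` descends to
  -- the spectrum of `Y`.
  have hq : Topology.IsQuotientMap (CharacterSpace.compContinuousMap i) :=
    (CharacterSpace.compContinuousMap i).continuous.isClosedMap.isQuotientMap
      (CharacterSpace.compContinuousMap i).continuous (compContinuousMap_surjective i hi)
  have hf : Function.FactorsThrough (gelfandStarTransform X a)
      (CharacterSpace.compContinuousMap i) := fun l m hlm => h l m fun y =>
    congrArg (fun k : characterSpace ℂ Y => k y) hlm
  obtain ⟨y, hy⟩ := exists_gelfand_eq (hq.lift (gelfandStarTransform X a) hf)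
  refine ⟨y, gelfand_ext fun l => ?_⟩
  have h1 := hy (CharacterSpace.compContinuousMap i l)
  exact h1.trans (DFunLike.congr_fun (hq.lift_comp (gelfandStarTransform X a) hf) l)

/-- The *-isomorphism dual to a homeomorphism of Gelfand spectra. -/
def starAlgEquivOfHomeo (f : characterSpace ℂ Y ≃ₜ characterSpace ℂ X) : X ≃⋆ₐ[ℂ] Y :=
  (gelfandStarTransform X).trans
    ((f.compStarAlgEquiv' ℂ ℂ).trans (gelfandStarTransform Y).symm)

theorem apply_starAlgEquivOfHomeo (f : characterSpace ℂ Y ≃ₜ characterSpace ℂ X) (a : X)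
    (l : characterSpace ℂ Y) : l (starAlgEquivOfHomeo f a) = f l a :=
  DFunLike.congr_fun ((gelfandStarTransform Y).apply_symm_apply
    (f.compStarAlgEquiv' ℂ ℂ (gelfandStarTransform X a))) l

/-- The homeomorphism of Gelfand spectra dual to a *-isomorphism. -/
def homeoOfStarAlgEquiv (φ : X ≃⋆ₐ[ℂ] Y) : characterSpace ℂ Y ≃ₜ characterSpace ℂ X where
  toFun := CharacterSpace.compContinuousMap (φ : X →⋆ₐ[ℂ] Y)
  invFun := CharacterSpace.compContinuousMap (φ.symm : Y →⋆ₐ[ℂ] X)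
  left_inv l := DFunLike.ext _ _ fun a => congrArg l (φ.apply_symm_apply a)
  right_inv l := DFunLike.ext _ _ fun a => congrArg l (φ.symm_apply_apply a)
  continuous_toFun := (CharacterSpace.compContinuousMap (φ : X →⋆ₐ[ℂ] Y)).continuous
  continuous_invFun := (CharacterSpace.compContinuousMap (φ.symm : Y →⋆ₐ[ℂ] X)).continuous

end Gelfand

/-! ### Contexts -/

namespace Context

variable {A : Type u} [CStarAlgebra A]

/-- The Gelfand spectrum of a context. -/
abbrev Spec (C : Context A) : Type u := WeakDual.characterSpace ℂ C.alg

theorem realPart_mem (C : StarSubalgebra ℂ A) {a : A} (ha : a ∈ C) :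
    (realPart a : A) ∈ C := by
  rw [realPart_apply_coe, ← Complex.coe_smul]
  exact C.smul_mem (add_mem ha (star_mem ha)) _

theorem imaginaryPart_mem (C : StarSubalgebra ℂ A) {a : A} (ha : a ∈ C) :
    (imaginaryPart a : A) ∈ C := by
  rw [imaginaryPart_apply_coe, ← Complex.coe_smul (2⁻¹ : ℝ)]
  exact C.smul_mem (C.smul_mem (sub_mem ha (star_mem ha)) _) _

theorem mem_iff_realPart_imaginaryPart (C : StarSubalgebra ℂ A) (a : A) :
    a ∈ C ↔ (realPart a : A) ∈ C ∧ (imaginaryPart a : A) ∈ C := by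
  refine ⟨fun h => ⟨realPart_mem C h, imaginaryPart_mem C h⟩, fun h => ?_⟩
  rw [← realPart_add_I_smul_imaginaryPart a]
  exact add_mem h.1 (C.smul_mem h.2 _)

theorem le_of_selfAdjoint {C D : Context A}
    (h : ∀ a : selfAdjoint A, (a : A) ∈ D.alg → (a : A) ∈ C.alg) : D ≤ C := fun a ha =>
  (mem_iff_realPart_imaginaryPart C.alg a).2
    ⟨h _ (realPart_mem _ ha), h _ (imaginaryPart_mem _ ha)⟩

theorem ext_of_selfAdjoint {C D : Context A}
    (h : ∀ a : selfAdjoint A, (a : A) ∈ D.alg ↔ (a : A) ∈ C.alg) : D = C :=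
  le_antisymm (le_of_selfAdjoint fun a => (h a).1) (le_of_selfAdjoint fun a => (h a).2)

/-- The intersection of a context with a closed *-subalgebra. -/
def restrict (C : Context A) (S : StarSubalgebra ℂ A) (hS : IsClosed (S : Set A)) : Context A :=
  ⟨C.alg ⊓ S, C.2.1.inter hS, fun x hx y hy => C.2.2 x hx.1 y hy.1⟩

/-- The intersection of two contexts. -/
def inter (C D : Context A) : Context A := C.restrict D.alg D.2.1

theorem inter_le_left (C D : Context A) : C.inter D ≤ C := fun _ h => h.1

theorem inter_le_right (C D : Context A) : C.inter D ≤ D := fun _ h => h.2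

/-- Intersection is the meet in the order of contexts, and order-isomorphisms preserve meets. -/
theorem map_inter {B : Type u} [CStarAlgebra B] (γ : Context A ≃o Context B) (C D : Context A) :
    γ (C.inter D) = (γ C).inter (γ D) := by
  refine le_antisymm (fun b hb => ⟨γ.monotone (inter_le_left C D) hb,
    γ.monotone (inter_le_right C D) hb⟩) ?_
  rw [← γ.symm_apply_le]
  exact fun a ha => ⟨(γ.symm_apply_le.2 (inter_le_left (γ C) (γ D))) ha,
    (γ.symm_apply_le.2 (inter_le_right (γ C) (γ D))) ha⟩

/-- A set of elements that commute with each other and with each other's adjoints lies in a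
context. -/
theorem exists_of_commute (S : Set A)
    (h : ∀ x ∈ S, ∀ y ∈ S, Commute x y ∧ Commute x (star y)) :
    ∃ C : Context A, S ⊆ C.alg := by
  -- Since `S` lies in its centralizer, the double centralizer does too, and is therefore
  -- commutative.
  have hS : S ⊆ StarSubalgebra.centralizer ℂ S := fun x hx =>
    (StarSubalgebra.mem_centralizer_iff ℂ).2 fun g hg =>
      ⟨(h g hg x hx).1.eq, (h x hx g hg).2.symm.eq⟩
  have hle : StarSubalgebra.centralizer ℂ (StarSubalgebra.centralizer ℂ S : Set A) ≤
      StarSubalgebra.centralizer ℂ S := StarSubalgebra.centralizer_le _ _ _ hS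
  refine ⟨⟨StarSubalgebra.centralizer ℂ (StarSubalgebra.centralizer ℂ S : Set A), ?_, ?_⟩, ?_⟩
  · rw [StarSubalgebra.coe_centralizer]
    exact Set.isClosed_centralizer _
  · intro x hx y hy
    exact (((StarSubalgebra.mem_centralizer_iff ℂ).1 hy) x (hle hx)).1
  · intro x hx
    refine (StarSubalgebra.mem_centralizer_iff ℂ).2 fun g hg => ?_
    have hg' : star g ∈ StarSubalgebra.centralizer ℂ S := star_mem hg
    exact ⟨(((StarSubalgebra.mem_centralizer_iff ℂ).1 hg) x hx).1.symm,
      (((StarSubalgebra.mem_centralizer_iff ℂ).1 hg') x hx).1.symm⟩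

/-- By Fuglede's theorem each element also commutes with the adjoint of the other. -/
theorem exists_mem_of_commute {x y : A} (hx : IsStarNormal x) (hy : IsStarNormal y)
    (h : Commute x y) : ∃ C : Context A, x ∈ C.alg ∧ y ∈ C.alg := by
  obtain ⟨C, hC⟩ := exists_of_commute {x, y} (by
    rintro a (rfl | rfl) b (rfl | rfl)
    exacts [⟨.refl _, hx.star_comm_self.symm⟩, ⟨h, hy.commute_star_right h⟩,
      ⟨h.symm, hx.commute_star_right h.symm⟩, ⟨.refl _, hy.star_comm_self.symm⟩])
  exact ⟨C, hC (by simp), hC (by simp)⟩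

theorem exists_mem {x : A} (hx : IsStarNormal x) : ∃ C : Context A, x ∈ C.alg :=
  let ⟨C, h, _⟩ := exists_mem_of_commute hx hx (.refl x)
  ⟨C, h⟩

theorem exists_upper_bound_of_commute (C D : Context A)
    (h : ∀ x ∈ C.alg, ∀ y ∈ D.alg, Commute x y) : ∃ E : Context A, C ≤ E ∧ D ≤ E := by
  obtain ⟨E, hE⟩ := exists_of_commute ((C.alg : Set A) ∪ D.alg) (by
    rintro x (hx | hx) y (hy | hy)
    · exact ⟨C.2.2 x hx y hy, C.2.2 x hx _ (star_mem hy)⟩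
    · exact ⟨h x hx y hy, h x hx _ (star_mem hy)⟩
    · exact ⟨(h y hy x hx).symm, (h _ (star_mem hy) x hx).symm⟩
    · exact ⟨D.2.2 x hx y hy, D.2.2 x hx _ (star_mem hy)⟩)
  exact ⟨E, fun x hx => hE (Or.inl hx), fun x hx => hE (Or.inr hx)⟩

instance (C : Context A) [Nontrivial A] : Nontrivial C.alg :=
  ⟨0, 1, fun h => zero_ne_one (congrArg Subtype.val h)⟩

theorem spec_ext {C : Context A} {a b : C.alg} (h : ∀ l : C.Spec, l a = l b) : a = b :=
  gelfand_ext h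

theorem incl_injective {C D : Context A} (h : D ≤ C) : Function.Injective (incl h) :=
  fun _ _ e => Subtype.ext (congrArg (Subtype.val : C.alg → A) e)

/-- Two characters of `C` agree on the subcontext `D`. -/
def Agree (C D : Context A) (l m : C.Spec) : Prop :=
  ∀ a : C.alg, (a : A) ∈ D.alg → l a = m a

/-- Stone-Weierstrass: a subcontext is recovered from the equivalence relation it induces on the
characters of `C`. -/
theorem mem_iff_forall_agree {C D : Context A} (h : D ≤ C) (a : C.alg) :
    (a : A) ∈ D.alg ↔ ∀ l m : C.Spec, Agree C D l m → l a = m a := by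
  have := mem_range_iff_forall_character (incl h) (incl_injective h) a
  constructor
  · intro ha l m hlm
    exact hlm a ha
  · intro H
    obtain ⟨d, rfl⟩ := this.2 fun l m hlm => H l m fun b hb => hlm ⟨b, hb⟩
    exact d.2

/-! ### Subcontexts obtained by collapsing a set of characters -/

theorem isClosed_map_val (C : Context A) {S : Set C.alg} (hS : IsClosed S) :
    IsClosed (Subtype.val '' S : Set A) :=
  C.2.1.isClosedEmbedding_subtypeVal.isClosedMap S hS

/-- The *-subalgebra of the elements of `C` that are constant on a set of characters. -/
def constOnAlg (C : Context A) (F : Set C.Spec) : StarSubalgebra ℂ C.alg where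
  carrier := {a | ∀ l ∈ F, ∀ m ∈ F, l a = m a}
  mul_mem' {a b} ha hb l hl m hm := by rw [map_mul, map_mul, ha l hl m hm, hb l hl m hm]
  add_mem' {a b} ha hb l hl m hm := by rw [map_add, map_add, ha l hl m hm, hb l hl m hm]
  algebraMap_mem' r l _ m _ := by rw [AlgHomClass.commutes, AlgHomClass.commutes]
  star_mem' {a} ha l hl m hm := by
    rw [characterSpace_apply_star, characterSpace_apply_star, ha l hl m hm]

theorem isClosed_constOnAlg (C : Context A) (F : Set C.Spec) :
    IsClosed (C.constOnAlg F : Set C.alg) := by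
  have : (C.constOnAlg F : Set C.alg) = ⋂ l ∈ F, ⋂ m ∈ F, {a : C.alg | l a = m a} := by
    ext a
    simp [constOnAlg]
  rw [this]
  exact isClosed_biInter fun l _ => isClosed_biInter fun m _ =>
    isClosed_eq (map_continuous l) (map_continuous m)

/-- The subcontext of the elements of `C` that are constant on a set of characters. -/
def constOn (C : Context A) (F : Set C.Spec) : Context A :=
  ⟨(C.constOnAlg F).map C.alg.subtype, C.isClosed_map_val (C.isClosed_constOnAlg F), by
    rintro _ ⟨x, -, rfl⟩ _ ⟨y, -, rfl⟩
    exact C.2.2 x x.2 y y.2⟩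

theorem constOn_le (C : Context A) (F : Set C.Spec) : C.constOn F ≤ C := by
  intro a h
  obtain ⟨x, -, rfl⟩ : ∃ x : C.alg, x ∈ C.constOnAlg F ∧ (x : A) = a := h
  exact x.2

theorem mem_constOn {C : Context A} {F : Set C.Spec} (a : C.alg) :
    (a : A) ∈ (C.constOn F).alg ↔ ∀ l ∈ F, ∀ m ∈ F, l a = m a := by
  constructor
  · intro h
    obtain ⟨x, hx, e⟩ : ∃ x : C.alg, x ∈ C.constOnAlg F ∧ (x : A) = a := h
    obtain rfl : x = a := Subtype.ext e
    exact hx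
  · intro h
    exact show ∃ x : C.alg, x ∈ C.constOnAlg F ∧ (x : A) = a from ⟨a, h, rfl⟩

theorem agree_constOn {C : Context A} {F : Set C.Spec} {l m : C.Spec} (hl : l ∈ F) (hm : m ∈ F) :
    Agree C (C.constOn F) l m := fun a ha => (mem_constOn a).1 ha l hl m hm

/-- Restriction to `C.constOn F` collapses `F` and, `F` being closed, identifies nothing else: for
`l` outside `F`, a Urysohn element equal to 1 at `l` and 0 on `F` and at `m` is constant on `F`. -/
theorem agree_constOn_iff {C : Context A} {F : Set C.Spec} (hF : IsClosed F) {l m : C.Spec} :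
    Agree C (C.constOn F) l m ↔ l = m ∨ l ∈ F ∧ m ∈ F := by
  constructor
  · intro h
    by_contra! hn
    wlog hl : l ∉ F generalizing l m
    · rw [not_not] at hl
      exact this (fun a ha => (h a ha).symm) ⟨hn.1.symm, fun h _ => hn.2 hl h⟩ (hn.2 hl)
    obtain ⟨a, h0, h1⟩ := exists_zero_one_of_isClosed (hF.union (isClosed_singleton (x := m)))
      (isClosed_singleton (x := l)) (by
        rw [Set.disjoint_singleton_right]
        rintro (h | h)
        exacts [hl h, hn.1 h])
    have := h a ((mem_constOn a).2 fun p hp q hq => by rw [h0 p (.inl hp), h0 q (.inl hq)])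
    rw [h1 l rfl, h0 m (.inr rfl)] at this
    exact one_ne_zero this
  · rintro (rfl | ⟨hl, hm⟩)
    · exact fun a _ => rfl
    · exact agree_constOn hl hm

end Context

/-! ### Recovering points from pairs of points -/

section Pairs

/-- A map on two-element sets that sends triangles to triangles is induced by an injection on
points. -/
theorem exists_point_map {X Y : Type*} (e : X → X → Set Y) (hX : ∀ x y : X, x ≠ y → ∃ z, z ≠ x ∧ z ≠ y)
    (hne : ∃ x y : X, x ≠ y)
    (htri : ∀ x y z, x ≠ y → x ≠ z → y ≠ z → ∃ s t r, s ≠ t ∧ s ≠ r ∧ t ≠ r ∧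
      e x y = {s, t} ∧ e x z = {s, r} ∧ e y z = {t, r})
    (hinj : ∀ x y z w, x ≠ w → y ≠ z → x ≠ y → x ≠ z → w ≠ y → w ≠ z → e x w ≠ e y z) :
    ∃ f : X → Y, Function.Injective f ∧ ∀ x y, x ≠ y → e x y = {f x, f y} := by
  have key : ∀ x : X, ∃ s : Y, ∀ y, y ≠ x → s ∈ e x y := by
    intro x
    obtain ⟨y, hy⟩ : ∃ y, y ≠ x := by
      obtain ⟨a, b, hab⟩ := hne
      by_cases h : a = x
      · exact ⟨b, h ▸ hab.symm⟩
      · exact ⟨a, h⟩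
    obtain ⟨z, hzx, hzy⟩ := hX x y hy.symm
    obtain ⟨s, t, r, hst, hsr, htr, h1, h2, h3⟩ := htri x y z hy.symm hzx.symm hzy.symm
    refine ⟨s, fun w hw => ?_⟩
    by_cases hwy : w = y
    · rw [hwy, h1]
      simp
    by_cases hwz : w = z
    · rw [hwz, h2]
      simp
    -- If `s` is missed, `e x w` must meet `e x y` in `t` and `e x z` in `r`. Then it equals `{t, r}
    -- = e y z`, against `hinj`.
    by_contra hs
    refine hinj x y z w hw.symm hzy.symm hy.symm hzx.symm hwy hwz ?_
    obtain ⟨s', t', r', hst', hsr', htr', h1', h2', h3'⟩ := htri x y w hy.symm hw.symm (Ne.symm hwy)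
    obtain ⟨s'', t'', r'', hst'', hsr'', htr'', h1'', h2'', h3''⟩ :=
      htri x z w hzx.symm hw.symm (Ne.symm hwz)
    have hs' : s' ∈ e x y ∧ s' ∈ e x w := by simp [h1', h2']
    have hs'' : s'' ∈ e x z ∧ s'' ∈ e x w := by simp [h1'', h2'']
    have e1 : s' = t := by
      have := hs'.1
      rw [h1] at this
      rcases this with rfl | h
      · exact absurd hs'.2 hs
      · exact h
    have e2 : s'' = r := by
      have := hs''.1
      rw [h2] at this
      rcases this with rfl | h
      · exact absurd hs''.2 hs
      · exact h
    rw [h3, h2', e1]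
    have h4 := hs''.2
    rw [e2, h2', e1] at h4
    rcases h4 with h4 | h4
    · exact absurd h4 htr.symm
    · rw [Set.mem_singleton_iff] at h4
      rw [h4]
  choose f hf using key
  -- Symmetry of `e` is not assumed. It follows by comparing the triangles on `x, y, z` and on `y,
  -- x, z`, which share two sides.
  have hcomm : ∀ x y, x ≠ y → e x y = e y x := by
    intro x y hxy
    obtain ⟨z, hzx, hzy⟩ := hX x y hxy
    obtain ⟨s, t, r, hst, hsr, htr, h1, h2, h3⟩ := htri x y z hxy hzx.symm hzy.symm
    obtain ⟨s', t', r', hst', hsr', htr', h1', h2', h3'⟩ := htri y x z hxy.symm hzy.symm hzx.symm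
    have a1 : s' ∈ e y z ∧ r' ∈ e y z := by simp [h2']
    have a2 : t' ∈ e x z ∧ r' ∈ e x z := by simp [h3']
    have a3 : s ∈ e x z ∧ r ∈ e x z := by simp [h2]
    have a4 : t ∈ e y z ∧ r ∈ e y z := by simp [h3]
    rw [h3] at a1
    rw [h2] at a2
    rw [h3'] at a3
    rw [h2'] at a4
    simp only [Set.mem_insert_iff, Set.mem_singleton_iff] at a1 a2 a3 a4
    have hr : r' = r := by
      rcases a1.2 with h | h
      · rcases a2.2 with h' | h'
        · exact absurd (h'.symm.trans h) hst
        · exact h'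
      · exact h
    have hs : s' = t := (a1.1.resolve_right fun h => hsr' (h.trans hr.symm))
    have ht : t' = s := (a2.1.resolve_right fun h => htr' (h.trans hr.symm))
    rw [h1, h1', hs, ht, Set.pair_comm]
  -- A common value would lie on all three sides of a triangle, which have no common point.
  have hinjf : ∀ x y, x ≠ y → f x ≠ f y := by
    intro x y hxy he
    obtain ⟨z, hzx, hzy⟩ := hX x y hxy
    obtain ⟨s, t, r, hst, hsr, htr, h1, h2, h3⟩ := htri x y z hxy hzx.symm hzy.symm
    have b1 := hf x y hxy.symm
    have b2 := hf x z hzx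
    have b3 := hf y z hzy
    rw [← he] at b3
    rw [h1] at b1
    rw [h2] at b2
    rw [h3] at b3
    simp only [Set.mem_insert_iff, Set.mem_singleton_iff] at b1 b2 b3
    grind
  refine ⟨f, fun x y h => by_contra fun hn => hinjf x y hn h, fun x y hxy => ?_⟩
  obtain ⟨z, hzx, hzy⟩ := hX x y hxy
  obtain ⟨s, t, r, hst, hsr, htr, h1, h2, h3⟩ := htri x y z hxy hzx.symm hzy.symm
  have b1 := hf x y hxy.symm
  have b2 := hf y x hxy
  have b3 := hinjf x y hxy
  rw [← hcomm x y hxy] at b2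
  rw [h1] at b1 b2 ⊢
  simp only [Set.mem_insert_iff, Set.mem_singleton_iff] at b1 b2
  rcases b1 with b1 | b1 <;> rcases b2 with b2 | b2
  · exact absurd (b1.trans b2.symm) b3
  · rw [b1, b2]
  · rw [b1, b2, Set.pair_comm]
  · exact absurd (b1.trans b2.symm) b3

/-- Three distinct pairs form a triangle if every set saturated for two of them is saturated for
the third. -/
theorem triangle_of_saturated {Y : Type*} {s₁ t₁ s₂ t₂ s₃ t₃ : Y}
    (n₁ : s₁ ≠ t₁) (n₂ : s₂ ≠ t₂) (n₃ : s₃ ≠ t₃)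
    (h₁₂ : ({s₁, t₁} : Set Y) ≠ {s₂, t₂}) (h₁₃ : ({s₁, t₁} : Set Y) ≠ {s₃, t₃})
    (h₂₃ : ({s₂, t₂} : Set Y) ≠ {s₃, t₃})
    (h : ∀ S : Set Y, (s₁ ∈ S ↔ t₁ ∈ S) → (s₂ ∈ S ↔ t₂ ∈ S) → (s₃ ∈ S ↔ t₃ ∈ S)) :
    ∃ s t r, s ≠ t ∧ s ≠ r ∧ t ≠ r ∧ ({s₁, t₁} : Set Y) = {s, t} ∧ ({s₂, t₂} : Set Y) = {s, r} ∧
      ({s₃, t₃} : Set Y) = {t, r} := by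
  -- The singletons force both points of the third pair into the union of the first two. If those
  -- share a point, only the remaining side is left; if they are disjoint, `H1` and `H2` make the
  -- third pair equal to one of them.
  have H1 := h {s₁, t₁}
  have H2 := h {s₂, t₂}
  have H3 := h {s₃}
  have H4 := h {s₁, t₁, s₂, t₂}
  have H5 := h {t₃}
  rw [Ne, Set.pair_eq_pair_iff] at h₁₂ h₁₃ h₂₃
  simp only [Set.mem_insert_iff, Set.mem_singleton_iff] at H1 H2 H3 H4 H5
  by_cases c1 : s₁ = s₂
  · refine ⟨s₁, t₁, t₂, n₁, c1 ▸ n₂, by grind, rfl, by rw [c1], ?_⟩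
    rw [Set.pair_eq_pair_iff]
    grind
  by_cases c2 : s₁ = t₂
  · refine ⟨s₁, t₁, s₂, n₁, c1, by grind, rfl, by rw [c2, Set.pair_comm], ?_⟩
    rw [Set.pair_eq_pair_iff]
    grind
  by_cases c3 : t₁ = s₂
  · refine ⟨t₁, s₁, t₂, n₁.symm, c3 ▸ n₂, c2, Set.pair_comm _ _, by rw [c3], ?_⟩
    rw [Set.pair_eq_pair_iff]
    grind
  by_cases c4 : t₁ = t₂
  · refine ⟨t₁, s₁, s₂, n₁.symm, c3, c1, Set.pair_comm _ _, by rw [c4, Set.pair_comm], ?_⟩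
    rw [Set.pair_eq_pair_iff]
    grind
  exfalso
  grind

end Pairs

/-! ### Coatoms below a context -/

namespace Context

variable {A B : Type u} [CStarAlgebra A] [CStarAlgebra B]

/-- The maximal proper subcontext of `C` on which two characters agree. -/
abbrev pair (C : Context A) (x y : C.Spec) : Context A := C.constOn {x, y}

theorem mem_pair {C : Context A} {x y : C.Spec} (a : C.alg) :
    (a : A) ∈ (C.pair x y).alg ↔ x a = y a := by
  rw [mem_constOn]
  simp only [Set.mem_insert_iff, Set.mem_singleton_iff, forall_eq_or_imp, forall_eq]
  grind

theorem agree_pair_iff {C : Context A} {x y l m : C.Spec} :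
    Agree C (C.pair x y) l m ↔ l = m ∨ (l = x ∨ l = y) ∧ (m = x ∨ m = y) :=
  agree_constOn_iff (Set.toFinite {x, y}).isClosed

/-- The dictionary between order and spectrum: agreement of characters becomes an inclusion, which
order-isomorphisms preserve. -/
theorem le_pair_iff {C D : Context A} (h : D ≤ C) {x y : C.Spec} :
    D ≤ C.pair x y ↔ Agree C D x y := by
  constructor
  · intro hD a ha
    exact (mem_pair a).1 (hD ha)
  · intro H a ha
    exact (mem_pair ⟨a, h ha⟩).2 (H ⟨a, h ha⟩ ha)

theorem pair_eq_pair_iff {C : Context A} {x y z w : C.Spec} (h : x ≠ y) :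
    C.pair x y = C.pair z w ↔ ({x, y} : Set C.Spec) = {z, w} := by
  constructor
  · intro e
    have h1 := agree_pair_iff.1 ((le_pair_iff (C.constOn_le _)).1 e.ge)
    rw [Set.pair_eq_pair_iff]
    grind
  · intro e
    rw [pair, e]

theorem exists_separating {C : Context A} {x y : C.Spec} (h : x ≠ y) :
    ∃ a : C.alg, x a = 0 ∧ y a = 1 := by
  obtain ⟨a, h0, h1⟩ := exists_zero_one_of_isClosed (isClosed_singleton (x := x))
    (isClosed_singleton (x := y)) (by simpa using h)
  exact ⟨a, h0 x rfl, h1 y rfl⟩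

/-- A proper subcontext fails to separate some two characters that differ on `C`, so it lies below
their pair. A pair is the kernel of the functional `x - y`, of codimension one, so nothing fits
strictly between it and `C`. -/
theorem covBy_iff {C D : Context A} :
    D ⋖ C ↔ ∃ x y : C.Spec, x ≠ y ∧ D = C.pair x y := by
  have hlt : ∀ {x y : C.Spec}, x ≠ y → C.pair x y < C := by
    intro x y hxy
    obtain ⟨a, h0, h1⟩ := exists_separating hxy
    refine lt_of_le_of_ne (C.constOn_le _) fun e => ?_
    have := (mem_pair (C := C) (x := x) (y := y) a).1 (by rw [e]; exact a.2)
    rw [h0, h1] at this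
    exact zero_ne_one this
  constructor
  · intro h
    obtain ⟨a, haC, haD⟩ : ∃ a : A, a ∈ C.alg ∧ a ∉ D.alg := by
      by_contra! hn
      exact h.lt.not_ge fun a ha => hn a ha
    have hn := mt (mem_iff_forall_agree h.le ⟨a, haC⟩).2 haD
    push Not at hn
    obtain ⟨x, y, hxy, hne⟩ := hn
    have hne' : x ≠ y := fun e => hne (by rw [e])
    refine ⟨x, y, hne', ?_⟩
    rcases h.eq_or_eq ((le_pair_iff h.le).2 hxy) (C.constOn_le _) with e | e
    · exact e.symm
    · exact absurd e (hlt hne').ne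
  · rintro ⟨x, y, hxy, rfl⟩
    refine ⟨hlt hxy, fun F hF hFC => hFC.not_ge fun c hc => ?_⟩
    obtain ⟨b, hbF, hb⟩ : ∃ b : A, b ∈ F.alg ∧ b ∉ (C.pair x y).alg := by
      by_contra! hn
      exact hF.not_ge fun a ha => hn a ha
    have hb' : x ⟨b, hFC.le hbF⟩ - y ⟨b, hFC.le hbF⟩ ≠ 0 := fun e =>
      hb ((mem_pair ⟨b, hFC.le hbF⟩).2 (sub_eq_zero.1 e))
    set b' : C.alg := ⟨b, hFC.le hbF⟩
    set c' : C.alg := ⟨c, hc⟩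
    -- The multiple of `b'` that equalizes the values of `c' - t • b'` at `x` and `y`.
    set t : ℂ := (x c' - y c') / (x b' - y b')
    have hd : ((c' - t • b' : C.alg) : A) ∈ (C.pair x y).alg := by
      refine (mem_pair _).2 ?_
      simp only [map_sub, map_smul, smul_eq_mul, t]
      field_simp
      ring
    have := add_mem (hF.le hd) (F.alg.smul_mem hbF t)
    simpa [c', b'] using this

/-- Some element of `C` restricts to the indicator function of `S` on the six characters, and
saturation for a pair says that this element belongs to the corresponding subcontext. -/
theorem saturated_of_inter_le {C : Context A} {s₁ t₁ s₂ t₂ s₃ t₃ : C.Spec}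
    (h : ∀ D, D ≤ C.pair s₁ t₁ → D ≤ C.pair s₂ t₂ → D ≤ C.pair s₃ t₃) (S : Set C.Spec)
    (h₁ : s₁ ∈ S ↔ t₁ ∈ S) (h₂ : s₂ ∈ S ↔ t₂ ∈ S) : s₃ ∈ S ↔ t₃ ∈ S := by
  set P : Set C.Spec := {s₁, t₁, s₂, t₂, s₃, t₃} with hP
  have hfin : P.Finite := Set.toFinite _
  obtain ⟨a, h0, h1⟩ := exists_zero_one_of_isClosed (hfin.subset Set.sdiff_subset).isClosed
    (hfin.subset Set.inter_subset_left).isClosed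
    (Set.disjoint_sdiff_inter (s := P) (t := S))
  have val : ∀ {s t}, s ∈ P → t ∈ P → ((s ∈ S ↔ t ∈ S) ↔ s a = t a) := by
    intro s t hs ht
    by_cases c1 : s ∈ S <;> by_cases c2 : t ∈ S
    · simp [c1, c2, h1 s ⟨hs, c1⟩, h1 t ⟨ht, c2⟩]
    · simp [c1, c2, h1 s ⟨hs, c1⟩, h0 t ⟨ht, c2⟩]
    · simp [c1, c2, h0 s ⟨hs, c1⟩, h1 t ⟨ht, c2⟩]
    · simp [c1, c2, h0 s ⟨hs, c1⟩, h0 t ⟨ht, c2⟩]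
  have m : s₁ ∈ P ∧ t₁ ∈ P ∧ s₂ ∈ P ∧ t₂ ∈ P ∧ s₃ ∈ P ∧ t₃ ∈ P := by simp [hP]
  obtain ⟨m1, m2, m3, m4, m5, m6⟩ := m
  rw [val m5 m6, ← mem_pair]
  exact h ((C.pair s₁ t₁).inter (C.pair s₂ t₂)) (inter_le_left _ _) (inter_le_right _ _)
    ⟨(mem_pair a).2 ((val m1 m2).1 h₁), (mem_pair a).2 ((val m3 m4).1 h₂)⟩

/-- A context is good if its spectrum does not have exactly two points. -/
def Good (C : Context A) : Prop := ∀ x y : C.Spec, x ≠ y → ∃ z, z ≠ x ∧ z ≠ y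

theorem good_of_three {C : Context A} {x y z : C.Spec} (h1 : x ≠ y) (h2 : x ≠ z) (h3 : y ≠ z) :
    C.Good := by
  intro a b _
  by_cases hx : x ≠ a ∧ x ≠ b
  · exact ⟨x, hx⟩
  by_cases hy : y ≠ a ∧ y ≠ b
  · exact ⟨y, hy⟩
  exact ⟨z, by grind⟩

theorem good_of_subsingleton {C : Context A} (h : Subsingleton C.Spec) : C.Good :=
  fun x y hxy => absurd (Subsingleton.elim x y) hxy

/-! ### The map of spectra induced by an order-isomorphism -/

theorem spec_subsingleton (γ : Context A ≃o Context B) {C : Context A} {C' : Context B}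
    (hC : γ C = C') (h : Subsingleton C.Spec) : Subsingleton C'.Spec := by
  subst hC
  refine ⟨fun s t => by_contra fun hst => ?_⟩
  -- Two characters of `γ C` give a coatom below it, and `γ.symm` carries that to a coatom below
  -- `C`.
  have : γ.symm ((γ C).pair s t) ⋖ C := by
    rw [← apply_covBy_apply_iff γ, γ.apply_symm_apply]
    exact covBy_iff.2 ⟨s, t, hst, rfl⟩
  obtain ⟨x, y, hxy, -⟩ := covBy_iff.1 this
  exact hxy (Subsingleton.elim x y)

/-- Coatoms go to coatoms, so pairs of characters go to pairs. Triangles go to triangles because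
anything below two sides is below the third, a condition on the order alone. -/
theorem exists_spec_injection [Nontrivial B] (γ : Context A ≃o Context B) {C : Context A}
    {C' : Context B} (hC : γ C = C') (hg : C.Good) :
    ∃ f : C.Spec → C'.Spec, Function.Injective f ∧
      ∀ x y, x ≠ y → γ (C.pair x y) = C'.pair (f x) (f y) := by
  by_cases hs : Subsingleton C.Spec
  · obtain ⟨s⟩ : Nonempty C'.Spec := inferInstance
    exact ⟨fun _ => s, fun x y _ => Subsingleton.elim x y,
      fun x y hxy => absurd (Subsingleton.elim x y) hxy⟩
  have hne : ∃ x y : C.Spec, x ≠ y := by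
    by_contra! hn
    exact hs ⟨hn⟩
  have hpair : ∀ x y : C.Spec, x ≠ y → ∃ s t : C'.Spec, s ≠ t ∧ γ (C.pair x y) = C'.pair s t := by
    intro x y hxy
    subst hC
    exact covBy_iff.1 ((apply_covBy_apply_iff γ).2 (covBy_iff.2 ⟨x, y, hxy, rfl⟩))
  set e : C.Spec → C.Spec → Set C'.Spec := fun x y =>
    {s | ∃ t, s ≠ t ∧ γ (C.pair x y) = C'.pair s t} with he
  have hes : ∀ {x y s t}, s ≠ t → γ (C.pair x y) = C'.pair s t → e x y = {s, t} := by
    intro x y s t hst h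
    ext r
    constructor
    · rintro ⟨r', hr, h'⟩
      rw [h, pair_eq_pair_iff hst] at h'
      rw [h']
      simp
    · rintro (rfl | rfl)
      · exact ⟨t, hst, h⟩
      · exact ⟨s, hst.symm, by rw [h, pair, Set.pair_comm]⟩
  have hdist : ∀ {x y z w s t s' t'}, x ≠ y → s ≠ t → ({x, y} : Set C.Spec) ≠ {z, w} →
      γ (C.pair x y) = C'.pair s t → γ (C.pair z w) = C'.pair s' t' →
      ({s, t} : Set C'.Spec) ≠ {s', t'} := by
    intro x y z w s t s' t' hxy hst hd h h' e'
    rw [← pair_eq_pair_iff hst, ← h, ← h', γ.injective.eq_iff, pair_eq_pair_iff hxy] at e'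
    exact hd e'
  obtain ⟨f, hf, hef⟩ := exists_point_map e hg hne (by
    intro x y z hxy hxz hyz
    obtain ⟨s₁, t₁, n₁, h₁⟩ := hpair x y hxy
    obtain ⟨s₂, t₂, n₂, h₂⟩ := hpair x z hxz
    obtain ⟨s₃, t₃, n₃, h₃⟩ := hpair y z hyz
    rw [hes n₁ h₁, hes n₂ h₂, hes n₃ h₃]
    refine triangle_of_saturated n₁ n₂ n₃ (hdist hxy n₁ ?_ h₁ h₂) (hdist hxy n₁ ?_ h₁ h₃)
      (hdist hxz n₂ ?_ h₂ h₃) (saturated_of_inter_le fun D hD₁ hD₂ => ?_)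
    · rw [Ne, Set.pair_eq_pair_iff]
      grind
    · rw [Ne, Set.pair_eq_pair_iff]
      grind
    · rw [Ne, Set.pair_eq_pair_iff]
      grind
    · rw [← h₁, ← γ.symm_apply_le] at hD₁
      rw [← h₂, ← γ.symm_apply_le] at hD₂
      rw [← h₃, ← γ.symm_apply_le]
      have hDC := hD₁.trans (C.constOn_le _)
      rw [le_pair_iff hDC] at hD₁ hD₂ ⊢
      exact fun a ha => (hD₁ a ha).symm.trans (hD₂ a ha)) (by
    intro x y z w hxw hyz hxy hxz hwy hwz
    obtain ⟨s₁, t₁, n₁, h₁⟩ := hpair x w hxw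
    obtain ⟨s₂, t₂, n₂, h₂⟩ := hpair y z hyz
    rw [hes n₁ h₁, hes n₂ h₂]
    refine hdist hxw n₁ ?_ h₁ h₂
    rw [Ne, Set.pair_eq_pair_iff]
    grind)
  refine ⟨f, hf, fun x y hxy => ?_⟩
  obtain ⟨s, t, n, h⟩ := hpair x y hxy
  rw [h, pair_eq_pair_iff n, ← hef x y hxy, hes n h]

theorem good_apply [Nontrivial B] (γ : Context A ≃o Context B) {C : Context A}
    {C' : Context B} (hC : γ C = C') (hg : C.Good) : C'.Good := by
  by_cases hs : Subsingleton C.Spec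
  · exact good_of_subsingleton (spec_subsingleton γ hC hs)
  have hne : ∃ x y : C.Spec, x ≠ y := by
    by_contra! hn
    exact hs ⟨hn⟩
  obtain ⟨x, y, hxy⟩ := hne
  obtain ⟨z, hzx, hzy⟩ := hg x y hxy
  obtain ⟨f, hf, -⟩ := exists_spec_injection γ hC hg
  exact good_of_three (hf.ne hxy) (hf.ne hzx.symm) (hf.ne hzy.symm)

/-- With a third point `z` at hand, `x` is the only common element of `{x, y}` and `{x, z}`. -/
theorem eq_of_pair_eq {C : Context A} (hg : C.Good) {f : C.Spec → C.Spec}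
    (h : ∀ x y, x ≠ y → C.pair x y = C.pair (f x) (f y)) (x : C.Spec) : f x = x := by
  by_cases hs : ∃ y, x ≠ y
  · obtain ⟨y, hxy⟩ := hs
    obtain ⟨z, hzx, hzy⟩ := hg x y hxy
    have h1 := (pair_eq_pair_iff hxy).1 (h x y hxy)
    have h2 := (pair_eq_pair_iff hzx.symm).1 (h x z hzx.symm)
    rw [Set.pair_eq_pair_iff] at h1 h2
    grind
  · push Not at hs
    exact (hs (f x)).symm

theorem exists_spec_equiv [Nontrivial A] [Nontrivial B] (γ : Context A ≃o Context B)
    {C : Context A} {C' : Context B} (hC : γ C = C') (hg : C.Good) :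
    ∃ f : C.Spec ≃ C'.Spec, ∀ x y, x ≠ y → γ (C.pair x y) = C'.pair (f x) (f y) := by
  have hg' := good_apply γ hC hg
  have hC' : γ.symm C' = C := by rw [← hC, γ.symm_apply_apply]
  obtain ⟨f, hf, hfp⟩ := exists_spec_injection γ hC hg
  obtain ⟨g, hgi, hgp⟩ := exists_spec_injection γ.symm hC' hg'
  have hgf : ∀ x, g (f x) = x := eq_of_pair_eq (f := fun x => g (f x)) hg fun x y hxy => by
    rw [← hgp _ _ (hf.ne hxy), ← hfp x y hxy, γ.symm_apply_apply]
  have hfg : ∀ x, f (g x) = x := eq_of_pair_eq (f := fun x => f (g x)) hg' fun x y hxy => by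
    rw [← hfp _ _ (hgi.ne hxy), ← hgp x y hxy, γ.apply_symm_apply]
  exact ⟨⟨f, g, hgf, hfg⟩, hfp⟩

/-- A closed `F` containing `x` is the class of `x` under agreement on `C.constOn F`. Its image is
then the class of `f x` under agreement on `γ (C.constOn F)`, and such classes are closed. -/
theorem exists_spec_homeo [Nontrivial A] [Nontrivial B] (γ : Context A ≃o Context B)
    {C : Context A} (hg : C.Good) :
    ∃ f : C.Spec ≃ₜ (γ C).Spec, ∀ D ≤ C, ∀ x y,
      Agree (γ C) (γ D) (f x) (f y) ↔ Agree C D x y := by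
  obtain ⟨f, hf⟩ := exists_spec_equiv γ rfl hg
  have key : ∀ D ≤ C, ∀ x y, Agree (γ C) (γ D) (f x) (f y) ↔ Agree C D x y := by
    intro D hD x y
    by_cases hxy : x = y
    · subst hxy
      exact ⟨fun _ _ _ => rfl, fun _ _ _ => rfl⟩
    rw [← le_pair_iff hD, ← le_pair_iff (γ.monotone hD), ← hf x y hxy, γ.le_iff_le]
  have hclosed : IsClosedMap f := by
    intro F hF
    rcases F.eq_empty_or_nonempty with rfl | ⟨x, hx⟩
    · simp
    have : f '' F = {t | Agree (γ C) (γ (C.constOn F)) t (f x)} := by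
      ext t
      obtain ⟨y, rfl⟩ := f.surjective t
      rw [Set.mem_ofPred_eq, key _ (C.constOn_le F), agree_constOn_iff hF,
        f.injective.mem_set_image]
      constructor
      · exact fun hy => .inr ⟨hy, hx⟩
      · rintro (rfl | h)
        exacts [hx, h.1]
    rw [this]
    simp only [Agree, Set.ofPred_forall]
    exact isClosed_iInter fun b => isClosed_iInter fun _ =>
      isClosed_eq ((WeakDual.eval_continuous b).comp continuous_subtype_val) continuous_const
  have hcont : Continuous f.symm := continuous_iff_isClosed.2 fun F hF => by
    rw [← f.image_eq_preimage_symm]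
    exact hclosed F hF
  exact ⟨(Continuous.homeoOfEquivCompactToT2 hcont).symm, key⟩

end Context

/-! ### Star homomorphisms implementing an order-isomorphism on a context -/

namespace Context

variable {A B : Type u} [CStarAlgebra A] [CStarAlgebra B]

/-- The *-homomorphism `κ` on `C` is injective and maps each subcontext `D` of `C` onto `γ D`. -/
structure Implements (γ : Context A ≃o Context B) (C : Context A) (κ : C.alg →⋆ₐ[ℂ] B) : Prop where
  injective : Function.Injective κ
  mem_iff : ∀ D ≤ C, ∀ b : B, b ∈ (γ D).alg ↔ ∃ a : C.alg, (a : A) ∈ D.alg ∧ κ a = b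

theorem Implements.apply_mem {γ : Context A ≃o Context B} {C : Context A} {κ : C.alg →⋆ₐ[ℂ] B}
    (h : Implements γ C κ) (a : C.alg) : κ a ∈ (γ C).alg :=
  (h.mem_iff C le_rfl _).2 ⟨a, a.2, rfl⟩

theorem Implements.apply_mem_iff {γ : Context A ≃o Context B} {C : Context A}
    {κ : C.alg →⋆ₐ[ℂ] B} (h : Implements γ C κ) {D : Context A} (hD : D ≤ C) (a : C.alg) :
    κ a ∈ (γ D).alg ↔ (a : A) ∈ D.alg := by
  rw [h.mem_iff D hD]
  refine ⟨fun ⟨a', ha', e⟩ => ?_, fun ha => ⟨a, ha, rfl⟩⟩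
  rwa [← h.injective e]

theorem Implements.comp_incl {γ : Context A ≃o Context B} {C : Context A}
    {κ : C.alg →⋆ₐ[ℂ] B} (h : Implements γ C κ) {D : Context A} (hD : D ≤ C) :
    Implements γ D (κ.comp (incl hD)) := by
  refine ⟨h.injective.comp (incl_injective hD), fun E hE b => ?_⟩
  rw [h.mem_iff E (hE.trans hD)]
  exact ⟨fun ⟨a, ha, e⟩ => ⟨⟨a, hE ha⟩, ha, e⟩, fun ⟨a, ha, e⟩ => ⟨incl hD a, ha, e⟩⟩

/-- The homomorphism is dual to the homeomorphism of spectra. It respects subcontexts because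
agreement of characters determines them. -/
theorem exists_implements [Nontrivial A] [Nontrivial B] (γ : Context A ≃o Context B)
    {C : Context A} (hg : C.Good) : ∃ κ : C.alg →⋆ₐ[ℂ] B, Implements γ C κ := by
  obtain ⟨f, hf⟩ := exists_spec_homeo γ hg
  let κ₀ : C.alg ≃⋆ₐ[ℂ] (γ C).alg := starAlgEquivOfHomeo f.symm
  have hκ : ∀ (a : C.alg) (t : (γ C).Spec), t (κ₀ a) = f.symm t a :=
    fun a t => apply_starAlgEquivOfHomeo f.symm a t
  have hκ' : ∀ (a : C.alg) (x : C.Spec), f x (κ₀ a) = x a := by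
    intro a x
    rw [hκ, f.symm_apply_apply]
  have key : ∀ D ≤ C, ∀ a : C.alg, ((κ₀ a : (γ C).alg) : B) ∈ (γ D).alg ↔ (a : A) ∈ D.alg := by
    intro D hD a
    rw [mem_iff_forall_agree hD, mem_iff_forall_agree (γ.monotone hD)]
    constructor
    · intro h x y hxy
      rw [← hκ' a x, ← hκ' a y]
      exact h _ _ ((hf D hD x y).2 hxy)
    · intro h s t hst
      obtain ⟨x, rfl⟩ := f.surjective s
      obtain ⟨y, rfl⟩ := f.surjective t
      rw [hκ', hκ']
      exact h _ _ ((hf D hD x y).1 hst)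
  refine ⟨(γ C).alg.subtype.comp (κ₀ : C.alg →⋆ₐ[ℂ] (γ C).alg), ?_, fun D hD b => ?_⟩
  · exact Subtype.val_injective.comp κ₀.injective
  constructor
  · intro hb
    obtain ⟨a, ha⟩ : ∃ a, κ₀ a = ⟨b, γ.monotone hD hb⟩ := κ₀.surjective _
    refine ⟨a, (key D hD a).1 ?_, congrArg Subtype.val ha⟩
    rw [ha]
    exact hb
  · rintro ⟨a, ha, rfl⟩
    exact (key D hD a).2 ha

/-- Each homomorphism pulls characters of `γ C` back to `C`, and its effect on pairs is prescribed
by `γ`. Points of a good spectrum are determined by the pairs containing them, so the pullbacks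
coincide. -/
theorem Implements.unique [Nontrivial A] [Nontrivial B] {γ : Context A ≃o Context B}
    {C : Context A} (hg : C.Good) {κ₁ κ₂ : C.alg →⋆ₐ[ℂ] B} (h₁ : Implements γ C κ₁)
    (h₂ : Implements γ C κ₂) : κ₁ = κ₂ := by
  have pull : ∀ κ : C.alg →⋆ₐ[ℂ] B, ∀ h : Implements γ C κ, ∃ f : (γ C).Spec → C.Spec,
      (∀ (s : (γ C).Spec) a, f s a = s ⟨κ a, h.apply_mem a⟩) ∧
      ∀ s t, s ≠ t → f s ≠ f t ∧ (γ C).pair s t = γ (C.pair (f s) (f t)) := by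
    intro κ h
    refine ⟨fun s => WeakDual.CharacterSpace.compContinuousMap
      (κ.codRestrict (γ C).alg h.apply_mem) s, fun s a => rfl, fun s t hst => ?_⟩
    constructor
    · intro e
      obtain ⟨⟨b, hb⟩, h0, h1⟩ := exists_separating hst
      obtain ⟨a, -, rfl⟩ := (h.mem_iff C le_rfl b).1 hb
      have := congrArg (fun k : C.Spec => k a) e
      exact zero_ne_one (h0.symm.trans (this.trans h1))
    · have aux : ∀ a : C.alg, κ a ∈ ((γ C).pair s t).alg ↔ κ a ∈ (γ (C.pair
          (WeakDual.CharacterSpace.compContinuousMap (κ.codRestrict (γ C).alg h.apply_mem) s)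
          (WeakDual.CharacterSpace.compContinuousMap
            (κ.codRestrict (γ C).alg h.apply_mem) t))).alg := by
        intro a
        rw [h.apply_mem_iff (C.constOn_le _), mem_pair]
        exact mem_pair (C := γ C) ⟨κ a, h.apply_mem a⟩
      refine le_antisymm (fun b hb => ?_) (fun b hb => ?_)
      · obtain ⟨a, -, rfl⟩ := (h.mem_iff C le_rfl b).1 (constOn_le _ _ hb)
        exact (aux a).1 hb
      · obtain ⟨a, -, rfl⟩ := (h.mem_iff C le_rfl b).1 (γ.monotone (C.constOn_le _) hb)
        exact (aux a).2 hb
  obtain ⟨f₁, e₁, p₁⟩ := pull κ₁ h₁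
  obtain ⟨f₂, e₂, p₂⟩ := pull κ₂ h₂
  have hpair : ∀ s t, s ≠ t → ({f₁ s, f₁ t} : Set C.Spec) = {f₂ s, f₂ t} := by
    intro s t hst
    rw [← pair_eq_pair_iff (p₁ s t hst).1, ← γ.injective.eq_iff, ← (p₁ s t hst).2,
      ← (p₂ s t hst).2]
  have hf : ∀ s, f₁ s = f₂ s := by
    intro s
    by_cases hs : ∃ t, s ≠ t
    · obtain ⟨t, hst⟩ := hs
      obtain ⟨r, hrs, hrt⟩ := good_apply γ rfl hg s t hst
      have q1 := hpair s t hst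
      have q2 := hpair s r hrs.symm
      have q3 := (p₂ t r hrt.symm).1
      have q4 := (p₁ t r hrt.symm).1
      rw [Set.pair_eq_pair_iff] at q1 q2
      grind
    · push Not at hs
      have : Subsingleton (γ C).Spec := ⟨fun a b => (hs a).symm.trans (hs b)⟩
      have := spec_subsingleton γ.symm (γ.symm_apply_apply C) this
      exact Subsingleton.elim _ _
  ext a
  have : (⟨κ₁ a, h₁.apply_mem a⟩ : (γ C).alg) = ⟨κ₂ a, h₂.apply_mem a⟩ :=
    spec_ext fun s => by rw [← e₁, ← e₂, hf]
  exact congrArg Subtype.val this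

/-! ### Coherence of the implementing homomorphisms -/

theorem good_of_le {D E : Context A} (h : D ≤ E) (hD : D.Good) (hne : ∃ x y : D.Spec, x ≠ y) :
    E.Good := by
  obtain ⟨x, y, hxy⟩ := hne
  obtain ⟨z, hzx, hzy⟩ := hD x y hxy
  have hs := compContinuousMap_surjective (incl h) (incl_injective h)
  obtain ⟨x, rfl⟩ := hs x
  obtain ⟨y, rfl⟩ := hs y
  obtain ⟨z, rfl⟩ := hs z
  exact good_of_three (x := x) (y := y) (z := z) (fun e => hxy (by rw [e]))
    (fun e => hzx (by rw [e])) (fun e => hzy (by rw [e]))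

/-- Both elements are block diagonal with respect to `p` and `1 - p`, and in each block one of them
is scalar. -/
theorem commute_of_corner {p c d : A} {z w : ℂ} (hp : p * p = p) (hc : Commute p c)
    (hd : Commute p d) (h1 : c * (1 - p) = z • (1 - p)) (h2 : d * p = w • p) : Commute c d := by
  have ec : c = c * p + z • (1 - p) := by rw [← h1]; noncomm_ring
  have ed : d = d * (1 - p) + w • p := by rw [← h2]; noncomm_ring
  have q1 : c * p * (d * (1 - p)) = 0 := by
    have : c * p * (d * (1 - p)) = c * (p * d) - c * (p * d) * p := by noncomm_ring
    rw [this, hd.eq, mul_assoc, mul_assoc d, hp, sub_self]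
  have q2 : d * (1 - p) * (c * p) = 0 := by
    have : d * (1 - p) * (c * p) = d * (c * p) - d * (p * c) * p := by noncomm_ring
    rw [this, hc.eq, mul_assoc d, mul_assoc c, hp, sub_self]
  have r1 : (1 - p) * (d * (1 - p)) = d * (1 - p) := by
    have : (1 - p) * (d * (1 - p)) = d * (1 - p) - (p * d) + (p * d) * p := by noncomm_ring
    rw [this, hd.eq, mul_assoc d, hp, sub_add_cancel]
  have r2 : d * (1 - p) * (1 - p) = d * (1 - p) := by
    have : d * (1 - p) * (1 - p) = d * (1 - p) - d * p + d * (p * p) := by noncomm_ring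
    rw [this, hp, sub_add_cancel]
  have r3 : c * p * p = c * p := by rw [mul_assoc, hp]
  have r4 : p * (c * p) = c * p := by rw [← mul_assoc, hc.eq, r3]
  have r5 : (1 - p) * p = 0 := by rw [sub_mul, one_mul, hp, sub_self]
  have r6 : p * (1 - p) = 0 := by rw [mul_sub, mul_one, hp, sub_self]
  rw [Commute, SemiconjBy, ec, ed]
  simp only [mul_add, add_mul, q1, q2, mul_smul_comm, smul_mul_assoc, r1, r2, r3, r4, r5, r6,
    smul_zero, add_zero, zero_add]
  abel

/-- A projection in a good context, trivial neither way, lies in a good subcontext that is scalar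
on one of the two corners. -/
theorem exists_corner {C : Context A} (hg : C.Good) {p : C.alg} (hp : p * p = p)
    {x y : C.Spec} (hx : x p = 0) (hy : y p = 1) :
    ∃ C₁ : Context A, C₁ ≤ C ∧ C₁.Good ∧ (∃ l m : C₁.Spec, l ≠ m) ∧ (p : A) ∈ C₁.alg ∧
      ((∀ c : C.alg, (c : A) ∈ C₁.alg → ∃ z : ℂ, c * (1 - p) = z • (1 - p)) ∨
        ∀ c : C.alg, (c : A) ∈ C₁.alg → ∃ z : ℂ, c * p = z • p) := by
  have h01 : ∀ l : C.Spec, l p = 0 ∨ l p = 1 := by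
    intro l
    have := congrArg l hp
    rw [map_mul] at this
    exact IsIdempotentElem.iff_eq_zero_or_one.1 this
  have hxy : x ≠ y := by
    rintro rfl
    exact zero_ne_one (hx.symm.trans hy)
  -- Collapse the fibre where `p` takes the value `r`. One character in it and two outside remain
  -- distinct, so three characters survive.
  have main : ∀ (r : ℂ) (x y w : C.Spec), x p = r → y p ≠ r → w p ≠ r → y ≠ w →
      (C.constOn {l | l p = r}).Good ∧ (∃ l m : (C.constOn {l | l p = r}).Spec, l ≠ m) ∧
      (p : A) ∈ (C.constOn {l | l p = r}).alg := by
    intro r x y w hx hy hw hyw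
    have hF : IsClosed {l : C.Spec | l p = r} :=
      isClosed_eq ((WeakDual.eval_continuous p).comp continuous_subtype_val) continuous_const
    set h := C.constOn_le {l : C.Spec | l p = r}
    have hdist : ∀ l m : C.Spec, ¬ Agree C (C.constOn {l | l p = r}) l m →
        WeakDual.CharacterSpace.compContinuousMap (incl h) l ≠
          WeakDual.CharacterSpace.compContinuousMap (incl h) m := by
      intro l m hn e
      refine hn fun a ha => ?_
      exact congrArg (fun k : (C.constOn {l | l p = r}).Spec => k ⟨a, ha⟩) e
    have d1 := hdist x y (by
      rw [agree_constOn_iff hF]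
      rintro (rfl | ⟨-, h⟩)
      exacts [hy hx, hy h])
    have d2 := hdist x w (by
      rw [agree_constOn_iff hF]
      rintro (rfl | ⟨-, h⟩)
      exacts [hw hx, hw h])
    have d3 := hdist y w (by
      rw [agree_constOn_iff hF]
      rintro (h | ⟨-, h⟩)
      exacts [hyw h, hw h])
    exact ⟨good_of_three d1 d2 d3, ⟨_, _, d1⟩,
      (mem_constOn p).2 fun l hl m hm => (show l p = r from hl).trans (show m p = r from hm).symm⟩
  -- The third character shares a fibre of `p` with `x` or with `y`; the other fibre is the one to
  -- collapse.
  obtain ⟨w, hwx, hwy⟩ := hg x y hxy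
  rcases h01 w with hw | hw
  · obtain ⟨g, hne, hmem⟩ := main 1 y x w hy (by rw [hx]; exact zero_ne_one)
      (by rw [hw]; exact zero_ne_one) hwx.symm
    refine ⟨_, C.constOn_le _, g, hne, hmem, .inr fun c hc => ⟨y c, spec_ext fun l => ?_⟩⟩
    rw [map_mul, map_smul, smul_eq_mul]
    rcases h01 l with hl | hl
    · rw [hl, mul_zero, mul_zero]
    · rw [(mem_constOn c).1 hc l hl y hy]
  · obtain ⟨g, hne, hmem⟩ := main 0 x y w hx (by rw [hy]; exact one_ne_zero)
      (by rw [hw]; exact one_ne_zero) hwy.symm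
    refine ⟨_, C.constOn_le _, g, hne, hmem, .inl fun c hc => ⟨x c, spec_ext fun l => ?_⟩⟩
    rw [map_mul, map_smul, smul_eq_mul, map_sub, map_one]
    rcases h01 l with hl | hl
    · rw [(mem_constOn c).1 hc l hl x hx]
    · rw [hl, sub_self, mul_zero, mul_zero]

theorem Implements.eq_of_le [Nontrivial A] [Nontrivial B] {γ : Context A ≃o Context B}
    {C D E : Context A} (hg : D.Good) {κ : C.alg →⋆ₐ[ℂ] B} {κ' : E.alg →⋆ₐ[ℂ] B}
    (h : Implements γ C κ) (h' : Implements γ E κ') (hC : D ≤ C) (hE : D ≤ E)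
    {a : A} (ha : a ∈ D.alg) : κ ⟨a, hC ha⟩ = κ' ⟨a, hE ha⟩ :=
  DFunLike.congr_fun ((h.comp_incl hC).unique hg (h'.comp_incl hE)) ⟨a, ha⟩

/-- Both values are compared with that of the homomorphism implementing `γ` on `E`, which is good
because it contains `D`, with at least three characters. -/
theorem Implements.eq_of_common [Nontrivial A] [Nontrivial B] {γ : Context A ≃o Context B}
    {C C' D D' E : Context A} (hg : D.Good) (hne : ∃ x y : D.Spec, x ≠ y) (hg' : D'.Good)
    {κ : C.alg →⋆ₐ[ℂ] B} {κ' : C'.alg →⋆ₐ[ℂ] B}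
    (h : Implements γ C κ) (h' : Implements γ C' κ') (hC : D ≤ C) (hC' : D' ≤ C')
    (hE : D ≤ E) (hE' : D' ≤ E) {a : A} (ha : a ∈ D.alg) (ha' : a ∈ D'.alg) :
    κ ⟨a, hC ha⟩ = κ' ⟨a, hC' ha'⟩ := by
  obtain ⟨κE, hκE⟩ := exists_implements γ (good_of_le hE hg hne)
  rw [h.eq_of_le hg hκE hC hE ha, h'.eq_of_le hg' hκE hC' hE' ha']

/-- In the flipped case, shrink to `D` and `D'`, each scalar on one corner of `p`. If the corners
are opposite, `D` and `D'` commute. If they are the same, the flip makes the corners of the images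
opposite, so `γ D` and `γ D'` commute. Either way `D` and `D'` lie in a common context. -/
theorem Implements.eq_projection [Nontrivial A] [Nontrivial B] {γ : Context A ≃o Context B}
    {C C' : Context A} (hg : C.Good) (hg' : C'.Good) {κ : C.alg →⋆ₐ[ℂ] B} {κ' : C'.alg →⋆ₐ[ℂ] B}
    (h : Implements γ C κ) (h' : Implements γ C' κ') {p : A} (hp : p * p = p)
    (hC : p ∈ C.alg) (hC' : p ∈ C'.alg) (hx : ∃ x : C.Spec, x ⟨p, hC⟩ = 0)
    (hy : ∃ y : C.Spec, y ⟨p, hC⟩ = 1) (hx' : ∃ x : C'.Spec, x ⟨p, hC'⟩ = 0)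
    (hy' : ∃ y : C'.Spec, y ⟨p, hC'⟩ = 1)
    (hor : κ' ⟨p, hC'⟩ = κ ⟨p, hC⟩ ∨ κ' ⟨p, hC'⟩ = 1 - κ ⟨p, hC⟩) :
    κ ⟨p, hC⟩ = κ' ⟨p, hC'⟩ := by
  rcases hor with hor | hor
  · exact hor.symm
  obtain ⟨x, hx⟩ := hx
  obtain ⟨y, hy⟩ := hy
  obtain ⟨x', hx'⟩ := hx'
  obtain ⟨y', hy'⟩ := hy'
  obtain ⟨D, hDC, gD, neD, pD, cor⟩ := exists_corner hg (Subtype.ext hp) hx hy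
  obtain ⟨D', hDC', gD', neD', pD', cor'⟩ := exists_corner hg' (Subtype.ext hp) hx' hy'
  have dom : (∀ c ∈ D.alg, ∀ d ∈ D'.alg, Commute c d) → κ ⟨p, hC⟩ = κ' ⟨p, hC'⟩ := by
    intro hcomm
    obtain ⟨E, hE, hE'⟩ := exists_upper_bound_of_commute D D' hcomm
    exact h.eq_of_common gD neD gD' h' hDC hDC' hE hE' pD pD'
  have im : (∀ c ∈ (γ D).alg, ∀ d ∈ (γ D').alg, Commute c d) → κ ⟨p, hC⟩ = κ' ⟨p, hC'⟩ := by
    intro hcomm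
    obtain ⟨E, hE, hE'⟩ := exists_upper_bound_of_commute (γ D) (γ D') hcomm
    rw [← γ.le_symm_apply] at hE hE'
    exact h.eq_of_common gD neD gD' h' hDC hDC' hE hE' pD pD'
  have comD : ∀ c ∈ D.alg, Commute p c := fun c hc => D.2.2 p pD c hc
  have comD' : ∀ c ∈ D'.alg, Commute p c := fun c hc => D'.2.2 p pD' c hc
  have hκp : κ ⟨p, hC⟩ * κ ⟨p, hC⟩ = κ ⟨p, hC⟩ := by
    rw [← map_mul]
    exact congrArg κ (Subtype.ext hp)
  have comκ : ∀ c : C.alg, Commute (κ ⟨p, hC⟩) (κ c) := fun c => (Commute.all _ c).map κ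
  have comκ' : ∀ c : C'.alg, Commute (κ ⟨p, hC⟩) (κ' c) := by
    intro c
    have : Commute (κ' ⟨p, hC'⟩) (κ' c) := (Commute.all _ c).map κ'
    rw [hor] at this
    simpa using (Commute.one_left (κ' c)).sub_left this
  rcases cor with cor | cor <;> rcases cor' with cor' | cor'
  · refine im fun c hc d hd => ?_
    obtain ⟨c, hcD, rfl⟩ := (h.mem_iff D hDC c).1 hc
    obtain ⟨d, hdD, rfl⟩ := (h'.mem_iff D' hDC' d).1 hd
    obtain ⟨z, hz⟩ := cor c hcD
    obtain ⟨w, hw⟩ := cor' d hdD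
    have hz' := congrArg κ hz
    have hw' := congrArg κ' hw
    rw [map_mul, map_smul, map_sub, map_one] at hz' hw'
    rw [hor, sub_sub_cancel] at hw'
    exact commute_of_corner hκp (comκ c) (comκ' d) hz' hw'
  · refine dom fun c hc d hd => ?_
    obtain ⟨z, hz⟩ := cor ⟨c, hDC hc⟩ hc
    obtain ⟨w, hw⟩ := cor' ⟨d, hDC' hd⟩ hd
    exact commute_of_corner hp (comD c hc) (comD' d hd) (congrArg Subtype.val hz)
      (congrArg Subtype.val hw)
  · refine dom fun c hc d hd => ?_
    obtain ⟨z, hz⟩ := cor ⟨c, hDC hc⟩ hc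
    obtain ⟨w, hw⟩ := cor' ⟨d, hDC' hd⟩ hd
    exact (commute_of_corner hp (comD' d hd) (comD c hc) (congrArg Subtype.val hw)
      (congrArg Subtype.val hz)).symm
  · refine im fun c hc d hd => ?_
    obtain ⟨c, hcD, rfl⟩ := (h.mem_iff D hDC c).1 hc
    obtain ⟨d, hdD, rfl⟩ := (h'.mem_iff D' hDC' d).1 hd
    obtain ⟨z, hz⟩ := cor c hcD
    obtain ⟨w, hw⟩ := cor' d hdD
    have hz' := congrArg κ hz
    have hw' := congrArg κ' hw
    rw [map_mul, map_smul] at hz' hw'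
    rw [hor] at hw'
    exact (commute_of_corner hκp (comκ' d) (comκ c) hw' hz').symm

/-- A context with exactly two characters is spanned by a projection and its complement. -/
theorem exists_projection {D : Context A} (hD : ¬ D.Good) :
    ∃ (p : D.alg) (x y : D.Spec), p * p = p ∧ star p = p ∧ x p = 0 ∧ y p = 1 ∧
      (∀ z : D.Spec, z = x ∨ z = y) ∧ ∀ d : D.alg, d = x d • (1 - p) + y d • p := by
  simp only [Good, not_forall, not_exists, not_and_or, not_not] at hD
  obtain ⟨x, y, hxy, hz⟩ := hD
  obtain ⟨p, hx, hy⟩ := exists_separating hxy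
  have ext2 : ∀ {a b : D.alg}, x a = x b → y a = y b → a = b := by
    intro a b h1 h2
    refine spec_ext fun l => ?_
    rcases hz l with rfl | rfl
    exacts [h1, h2]
  refine ⟨p, x, y, ext2 ?_ ?_, ext2 ?_ ?_, hx, hy, hz, fun d => ext2 ?_ ?_⟩
  · rw [map_mul, hx, mul_zero]
  · rw [map_mul, hy, mul_one]
  · rw [characterSpace_apply_star, hx, star_zero]
  · rw [characterSpace_apply_star, hy, star_one]
  · simp [hx]
  · simp [hy]

/-- A two-point intersection is spanned by `p` and `1 - p`. Both homomorphisms map it onto the same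
algebra, whose only nontrivial idempotents are the images of these two, so
`Implements.eq_projection` settles the only ambiguity. -/
theorem Implements.coherent [Nontrivial A] [Nontrivial B] {γ : Context A ≃o Context B}
    {C C' : Context A} (hg : C.Good) (hg' : C'.Good) {κ : C.alg →⋆ₐ[ℂ] B} {κ' : C'.alg →⋆ₐ[ℂ] B}
    (h : Implements γ C κ) (h' : Implements γ C' κ') {a : A} (ha : a ∈ C.alg) (ha' : a ∈ C'.alg) :
    κ ⟨a, ha⟩ = κ' ⟨a, ha'⟩ := by
  by_cases hD : (C.inter C').Good
  · exact h.eq_of_le hD h' (inter_le_left C C') (inter_le_right C C') ⟨ha, ha'⟩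
  obtain ⟨p, x, y, hp, -, hx, hy, hz, hspan⟩ := exists_projection hD
  have hDC := inter_le_left C C'
  have hDC' := inter_le_right C C'
  have lift : ∀ {E : Context A} (hE : C.inter C' ≤ E) (l : (C.inter C').Spec),
      ∃ m : E.Spec, m (incl hE p) = l p := by
    intro E hE l
    obtain ⟨m, hm⟩ := compContinuousMap_surjective (incl hE) (incl_injective hE) l
    exact ⟨m, congrArg (fun k : (C.inter C').Spec => k p) hm⟩
  have e01 : ∀ z : ℂ, z * z = z → z = 0 ∨ z = 1 := fun z hz =>
    IsIdempotentElem.iff_eq_zero_or_one.1 hz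
  have hor : κ' (incl hDC' p) = κ (incl hDC p) ∨ κ' (incl hDC' p) = 1 - κ (incl hDC p) := by
    obtain ⟨d, hd, e⟩ := (h.mem_iff _ hDC _).1 ((h'.apply_mem_iff hDC' (incl hDC' p)).2 p.2)
    have hd2 : d * d = d := h.injective (by rw [map_mul, e, ← map_mul, ← map_mul, hp])
    have hd2' : (⟨d, hd⟩ * ⟨d, hd⟩ : (C.inter C').alg) = ⟨d, hd⟩ :=
      Subtype.ext (congrArg (Subtype.val : C.alg → A) hd2)
    have hs := hspan ⟨d, hd⟩
    have X := e01 (x ⟨d, hd⟩) (by rw [← map_mul, hd2'])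
    have Y := e01 (y ⟨d, hd⟩) (by rw [← map_mul, hd2'])
    have hdp : ∀ q : (C.inter C').alg, (⟨d, hd⟩ : (C.inter C').alg) = q → d = incl hDC q :=
      fun q hq => Subtype.ext (congrArg (Subtype.val : (C.inter C').alg → A) hq)
    rcases X with X | X <;> rcases Y with Y | Y <;> rw [X, Y] at hs
    · exfalso
      have : d = 0 := by simpa using hdp 0 (by simpa using hs)
      rw [this, map_zero] at e
      have : p = 0 := (h'.comp_incl hDC').injective (e.symm.trans (map_zero _).symm)
      rw [this, map_zero] at hy
      exact zero_ne_one hy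
    · left
      rw [← e, hdp p (by simpa using hs)]
    · right
      rw [← e, hdp (1 - p) (by simpa using hs), map_sub, map_one, map_sub, map_one]
    · exfalso
      have : d = 1 := by simpa using hdp 1 (by simpa using hs)
      rw [this, map_one] at e
      have : p = 1 := (h'.comp_incl hDC').injective (e.symm.trans (map_one _).symm)
      rw [this, map_one] at hx
      exact one_ne_zero hx
  have hpp : κ (incl hDC p) = κ' (incl hDC' p) := by
    refine h.eq_projection hg hg' h' (congrArg Subtype.val hp) _ _ ?_ ?_ ?_ ?_ hor
    · exact (lift hDC x).imp fun m hm => hm.trans hx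
    · exact (lift hDC y).imp fun m hm => hm.trans hy
    · exact (lift hDC' x).imp fun m hm => hm.trans hx
    · exact (lift hDC' y).imp fun m hm => hm.trans hy
  have hs := hspan ⟨a, ha, ha'⟩
  set α := x ⟨a, ha, ha'⟩
  set β := y ⟨a, ha, ha'⟩
  have s1 : (⟨a, ha⟩ : C.alg) = α • (1 - incl hDC p) + β • incl hDC p :=
    Subtype.ext (congrArg (Subtype.val : (C.inter C').alg → A) hs)
  have s2 : (⟨a, ha'⟩ : C'.alg) = α • (1 - incl hDC' p) + β • incl hDC' p :=
    Subtype.ext (congrArg (Subtype.val : (C.inter C').alg → A) hs)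
  rw [s1, s2]
  simp only [map_add, map_smul, map_sub, map_one, hpp]

end Context

/-! ### Algebras with a nontrivial projection whose corners are one-dimensional -/

section Corners

variable {A : Type u} [CStarAlgebra A]

/-- The scalar is real by self-adjointness. It lies in the spectrum of the positive element `v *
star v`, because `c - c • p` is annihilated by the nonzero `p`. -/
theorem exists_pos_of_mul_star_eq_smul {p v : A} {c : ℂ} (hp : p * p = p) (hps : star p = p)
    (hp0 : p ≠ 0) (hv : v ≠ 0) (h : v * star v = c • p) : ∃ r : ℝ, 0 < r ∧ c = r := by
  have hc : star c = c := by
    have h1 : star (v * star v) = v * star v := by rw [star_mul, star_star]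
    rw [h, star_smul, hps, ← sub_eq_zero, ← sub_smul, smul_eq_zero, sub_eq_zero] at h1
    exact h1.resolve_right hp0
  obtain ⟨r, rfl⟩ := Complex.conj_eq_iff_real.1 hc
  have hvv : v * star v ≠ 0 := by
    rw [Ne, CStarRing.mul_star_self_eq_zero_iff]
    exact hv
  have hr0 : r ≠ 0 := by
    rintro rfl
    rw [h, Complex.ofReal_zero, zero_smul] at hvv
    exact hvv rfl
  refine ⟨r, lt_of_le_of_ne ?_ hr0.symm, rfl⟩
  refine spectrum_star_mul_self_nonneg (b := star v) r ?_
  rw [star_star, h, spectrum.mem_iff]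
  rintro hu
  have : (algebraMap ℝ A r - (r : ℂ) • p) * p = 0 := by
    rw [sub_mul, Algebra.algebraMap_eq_smul_one, smul_mul_assoc, smul_mul_assoc, hp, one_mul,
      Complex.coe_smul, sub_self]
  exact hp0 (hu.mul_right_eq_zero.1 this)

theorem nonempty_starAlgEquiv_prod {p : A} (hp : p * p = p) (hps : star p = p)
    (hp0 : p ≠ 0) (hp1 : 1 - p ≠ 0) (h1 : ∀ a, ∃ c : ℂ, p * a * p = c • p)
    (h2 : ∀ a, ∃ c : ℂ, (1 - p) * a * (1 - p) = c • (1 - p)) (h : ∀ a, p * a * (1 - p) = 0) :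
    Nonempty (A ≃⋆ₐ[ℂ] ℂ × ℂ) := by
  have hpq : p * (1 - p) = 0 := by rw [mul_sub, mul_one, hp, sub_self]
  have hqp : (1 - p) * p = 0 := by rw [sub_mul, one_mul, hp, sub_self]
  have hq : (1 - p) * (1 - p) = 1 - p := by rw [mul_sub, mul_one, hqp, sub_zero]
  have hqs : star (1 - p) = 1 - p := by rw [star_sub, star_one, hps]
  have h' : ∀ a, (1 - p) * a * p = 0 := by
    intro a
    have := congrArg star (h (star a))
    rwa [star_mul, star_mul, hqs, hps, star_star, star_zero, ← mul_assoc] at this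
  generalize hqdef : 1 - p = q at *
  have h1q : (1 : A) = p + q := by rw [← hqdef]; abel
  let f : ℂ × ℂ →⋆ₐ[ℂ] A :=
    { toFun := fun z => z.1 • p + z.2 • q
      map_one' := by rw [h1q]; simp
      map_mul' := fun z w => by
        simp only [Prod.fst_mul, Prod.snd_mul, mul_add, add_mul, smul_mul_assoc, mul_smul_comm,
          hp, hq, hpq, hqp, smul_zero, add_zero, zero_add, smul_smul, mul_comm]
      map_zero' := by simp
      map_add' := fun z w => by
        simp only [Prod.fst_add, Prod.snd_add, add_smul]
        abel
      commutes' := fun z => by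
        rw [Algebra.algebraMap_eq_smul_one (A := A), h1q, smul_add]
        rfl
      map_star' := fun z => by
        simp only [Prod.fst_star, Prod.snd_star, star_add, star_smul, hps, hqs] }
  have hf : ∀ z, f z = z.1 • p + z.2 • q := fun z => rfl
  refine ⟨(StarAlgEquiv.ofBijective f ⟨?_, fun a => ?_⟩).symm⟩
  · rw [injective_iff_map_eq_zero]
    intro z hz
    rw [hf] at hz
    have k1 := congrArg (p * ·) hz
    have k2 := congrArg (q * ·) hz
    simp only [mul_add, mul_smul_comm, hp, hq, hpq, hqp, smul_zero, add_zero, zero_add, mul_zero,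
      smul_eq_zero, hp0, hp1, or_false] at k1 k2
    exact Prod.ext k1 k2
  · obtain ⟨c, hc⟩ := h1 a
    obtain ⟨d, hd⟩ := h2 a
    refine ⟨(c, d), ?_⟩
    have : a = p * a * p + p * a * q + q * a * p + q * a * q := by
      calc a = (p + q) * a * (p + q) := by rw [← h1q, one_mul, mul_one]
        _ = _ := by noncomm_ring
    rw [this, h, h', hc, hd, hf, add_zero, add_zero]

/-- The elements `p`, `v`, `star v`, `1 - p` are matrix units. They span because multiplication by
`v` reduces the off-diagonal corners to a scalar corner. -/
theorem nonempty_starAlgEquiv_matrix {p v : A} (hp : p * p = p) (hps : star p = p)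
    (hp0 : p ≠ 0) (h1 : ∀ a, ∃ c : ℂ, p * a * p = c • p)
    (h2 : ∀ a, ∃ c : ℂ, (1 - p) * a * (1 - p) = c • (1 - p))
    (hpv : p * v = v) (hvp : v * p = 0) (hvv : v * star v = p) (hvv' : star v * v = 1 - p) :
    Nonempty (A ≃⋆ₐ[ℂ] Matrix (Fin 2) (Fin 2) ℂ) := by
  have hpq : p * (1 - p) = 0 := by rw [mul_sub, mul_one, hp, sub_self]
  have hqp : (1 - p) * p = 0 := by rw [sub_mul, one_mul, hp, sub_self]
  have hq : (1 - p) * (1 - p) = 1 - p := by rw [mul_sub, mul_one, hqp, sub_zero]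
  have hqs : star (1 - p) = 1 - p := by rw [star_sub, star_one, hps]
  have hvq : v * (1 - p) = v := by rw [mul_sub, mul_one, hvp, sub_zero]
  have hqv : (1 - p) * v = 0 := by rw [sub_mul, one_mul, hpv, sub_self]
  generalize hqdef : 1 - p = q at *
  have h1q : (1 : A) = p + q := by rw [← hqdef]; abel
  have hvv0 : v * v = 0 := by
    calc v * v = v * (p * v) := by rw [hpv]
      _ = 0 := by rw [← mul_assoc, hvp, zero_mul]
  set w := star v with hw
  have hwp : w * p = w := by rw [hw, ← hps, ← star_mul, hpv]
  have hpw : p * w = 0 := by rw [hw, ← hps, ← star_mul, hvp, star_zero]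
  have hqw : q * w = w := by rw [hw, ← hqs, ← star_mul, hvq]
  have hwq : w * q = 0 := by rw [hw, ← hqs, ← star_mul, hqv, star_zero]
  have hww : w * w = 0 := by rw [hw, ← star_mul, hvv0, star_zero]
  have hws : star w = v := star_star v
  have hv0 : v ≠ 0 := by
    rintro h
    rw [h, zero_mul] at hvv
    exact hp0 hvv.symm
  have hw0 : w ≠ 0 := by
    rintro h
    rw [h, mul_zero] at hvv
    exact hp0 hvv.symm
  have hq0 : q ≠ 0 := by
    rintro h
    rw [h, mul_zero] at hvq
    exact hv0 hvq.symm
  let f : Matrix (Fin 2) (Fin 2) ℂ →⋆ₐ[ℂ] A :=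
    { toFun := fun M => M 0 0 • p + M 0 1 • v + M 1 0 • w + M 1 1 • q
      map_one' := by rw [h1q]; simp
      map_mul' := fun M N => by
        simp only [Matrix.mul_apply, Fin.sum_univ_two, mul_add, add_mul, smul_mul_assoc,
          mul_smul_comm, hp, hq, hpq, hqp, hpv, hvp, hvq, hqv, hvv0, hwp, hpw, hqw, hwq, hww,
          hvv, hvv', smul_zero, add_zero, zero_add]
        module
      map_zero' := by simp
      map_add' := fun M N => by
        simp only [Matrix.add_apply, add_smul]
        abel
      commutes' := fun z => by
        rw [Algebra.algebraMap_eq_smul_one, Algebra.algebraMap_eq_smul_one, h1q, smul_add]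
        simp
      map_star' := fun M => by
        simp only [Matrix.star_apply, star_add, star_smul, hps, hqs, hws, ← hw]
        abel }
  have hf : ∀ M, f M = M 0 0 • p + M 0 1 • v + M 1 0 • w + M 1 1 • q := fun M => rfl
  refine ⟨(StarAlgEquiv.ofBijective f ⟨?_, fun a => ?_⟩).symm⟩
  · rw [injective_iff_map_eq_zero]
    intro M hM
    rw [hf] at hM
    have k1 := congrArg (fun x => p * x * p) hM
    have k2 := congrArg (fun x => p * x * q) hM
    have k3 := congrArg (fun x => q * x * p) hM
    have k4 := congrArg (fun x => q * x * q) hM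
    simp only [mul_add, add_mul, mul_smul_comm, smul_mul_assoc, hp, hq, hpq, hqp, hpv, hvp, hvq,
      hqv, hwp, hpw, hqw, hwq, smul_zero, add_zero, zero_add, mul_zero, zero_mul, smul_eq_zero,
      hp0, hq0, hv0, hw0, or_false] at k1 k2 k3 k4
    ext i j
    fin_cases i <;> fin_cases j
    exacts [k1, k2, k3, k4]
  · have corner : ∀ a, ∃ c : ℂ, p * a * q = c • v := by
      intro a
      obtain ⟨c, hc⟩ := h2 (w * a)
      refine ⟨c, ?_⟩
      calc p * a * q = v * (q * (w * a) * q) := by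
            rw [← hvv]
            simp only [← mul_assoc, hvq]
        _ = c • v := by rw [hc, mul_smul_comm, hvq]
    obtain ⟨c, hc⟩ := h1 a
    obtain ⟨d, hd⟩ := h2 a
    obtain ⟨s, hs⟩ := corner a
    obtain ⟨t, ht⟩ := corner (star a)
    have ht' := congrArg star ht
    rw [star_mul, star_mul, hqs, hps, star_star, star_smul, ← hw, ← mul_assoc] at ht'
    refine ⟨!![c, s; star t, d], ?_⟩
    have : a = p * a * p + p * a * q + q * a * p + q * a * q := by
      calc a = (p + q) * a * (p + q) := by rw [← h1q, one_mul, mul_one]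
        _ = _ := by noncomm_ring
    rw [this, hc, hd, hs, ht', hf]
    rfl

/-- If the off-diagonal part vanishes, `A` is `ℂ²`. Otherwise a nonzero off-diagonal `u` has `u *
star u = r • p` with `r > 0`, and dividing by `√r` gives a partial isometry between `p` and `1 - p`.
-/
theorem nonempty_starAlgEquiv_of_corners {p : A} (hp : p * p = p) (hps : star p = p)
    (hp0 : p ≠ 0) (hp1 : 1 - p ≠ 0) (h1 : ∀ a, ∃ c : ℂ, p * a * p = c • p)
    (h2 : ∀ a, ∃ c : ℂ, (1 - p) * a * (1 - p) = c • (1 - p)) :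
    Nonempty (A ≃⋆ₐ[ℂ] ℂ × ℂ) ∨ Nonempty (A ≃⋆ₐ[ℂ] Matrix (Fin 2) (Fin 2) ℂ) := by
  by_cases h : ∀ a, p * a * (1 - p) = 0
  · exact .inl (nonempty_starAlgEquiv_prod hp hps hp0 hp1 h1 h2 h)
  right
  push Not at h
  obtain ⟨a, ha⟩ := h
  have hqp : (1 - p) * p = 0 := by rw [sub_mul, one_mul, hp, sub_self]
  set u := p * a * (1 - p)
  have hpu : p * u = u := by rw [← mul_assoc, ← mul_assoc, hp]
  have hup : u * p = 0 := by rw [mul_assoc, hqp, mul_zero]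
  have huq : u * (1 - p) = u := by rw [mul_sub, mul_one, hup, sub_zero]
  clear_value u
  obtain ⟨c, hc⟩ := h1 (u * star u)
  have hsu : star u * p = star u := by
    conv_lhs => rw [← hps]
    rw [← star_mul, hpu]
  have hc' : u * star u = c • p := by
    rw [← hc, ← mul_assoc, hpu, mul_assoc, hsu]
  obtain ⟨r, hr, rfl⟩ := exists_pos_of_mul_star_eq_smul hp hps hp0 ha hc'
  set t : ℂ := (((Real.sqrt r)⁻¹ : ℝ) : ℂ) with ht
  have htt : t * t * r = 1 := by
    rw [ht, ← Complex.ofReal_mul, ← Complex.ofReal_mul, ← mul_inv, Real.mul_self_sqrt hr.le,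
      inv_mul_cancel₀ hr.ne', Complex.ofReal_one]
  have hts : star t = t := Complex.conj_ofReal _
  have hvv : (t • u) * star (t • u) = p := by
    rw [star_smul, hts, smul_mul_smul_comm, hc', smul_smul, htt, one_smul]
  have hpv : p * (t • u) = t • u := by rw [mul_smul_comm, hpu]
  have hvp : (t • u) * p = 0 := by rw [smul_mul_assoc, hup, smul_zero]
  have hvq : (t • u) * (1 - p) = t • u := by rw [smul_mul_assoc, huq]
  generalize t • u = v at hvv hpv hvp hvq
  have hsq : (1 - p) * star v = star v := by
    have := congrArg star hvq
    rwa [star_mul, star_sub, star_one, hps] at this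
  obtain ⟨d, hd⟩ := h2 (star v * v)
  rw [← mul_assoc, hsq, mul_assoc, hvq] at hd
  have hdd : d * d = d := by
    have : star v * v * (star v * v) = star v * v := by
      rw [mul_assoc, ← mul_assoc v, hvv, hpv]
    rw [hd, smul_mul_smul_comm, ← sub_eq_zero] at this
    have hq : (1 - p) * (1 - p) = 1 - p := by rw [mul_sub, mul_one, hqp, sub_zero]
    rw [hq, ← sub_smul, smul_eq_zero, sub_eq_zero] at this
    exact this.resolve_right hp1
  rcases IsIdempotentElem.iff_eq_zero_or_one.1 hdd with rfl | rfl
  · rw [zero_smul, CStarRing.star_mul_self_eq_zero_iff] at hd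
    rw [hd, zero_mul] at hvv
    exact absurd hvv.symm hp0
  · rw [one_smul] at hd
    exact nonempty_starAlgEquiv_matrix hp hps hp0 h1 h2 hpv hvp hvv hd

/-- Apart from `ℂ²` and `B(ℂ²)`, good contexts are cofinal. -/
theorem Context.exists_good_ge [Nontrivial A] (hA₁ : IsEmpty (A ≃⋆ₐ[ℂ] (ℂ × ℂ)))
    (hA₂ : IsEmpty (A ≃⋆ₐ[ℂ] (EuclideanSpace ℂ (Fin 2) →L[ℂ] EuclideanSpace ℂ (Fin 2))))
    (C₀ : Context A) : ∃ C, C₀ ≤ C ∧ C.Good := by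
  by_contra! hno
  obtain ⟨p, x, y, hp, hps, hx, hy, -, hspan⟩ := exists_projection (hno C₀ le_rfl)
  have hp' : (p : A) * p = p := congrArg Subtype.val hp
  have hps' : star (p : A) = p := congrArg Subtype.val hps
  have hp0 : (p : A) ≠ 0 := by
    intro h
    have h : p = 0 := Subtype.ext h
    rw [h, map_zero] at hy
    exact zero_ne_one hy
  have hp1 : 1 - (p : A) ≠ 0 := by
    intro h
    have h : p = 1 := Subtype.ext (sub_eq_zero.1 h).symm
    rw [h, map_one] at hx
    exact one_ne_zero hx
  have hqp : (1 - (p : A)) * p = 0 := by rw [sub_mul, one_mul, hp', sub_self]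
  have hpq : (p : A) * (1 - p) = 0 := by rw [mul_sub, mul_one, hp', sub_self]
  have hq : (1 - (p : A)) * (1 - p) = 1 - p := by rw [mul_sub, mul_one, hqp, sub_zero]
  have hqs : star (1 - (p : A)) = 1 - p := by rw [star_sub, star_one, hps']
  -- A context containing `h` and `p` contains `C₀`, so it is not good. It then has just two
  -- characters, already separated by `p`.
  have key : ∀ h : A, IsSelfAdjoint h → Commute (p : A) h →
      ∃ α β : ℂ, h = α • (1 - (p : A)) + β • (p : A) := by
    intro h hh hc
    obtain ⟨C, hpC, hhC⟩ := exists_mem_of_commute (IsSelfAdjoint.isStarNormal hps')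
      hh.isStarNormal hc
    have hle : C₀ ≤ C := by
      intro d hd
      have := congrArg (Subtype.val : C₀.alg → A) (hspan ⟨d, hd⟩)
      have e : d = x ⟨d, hd⟩ • (1 - (p : A)) + y ⟨d, hd⟩ • (p : A) := this
      rw [e]
      exact add_mem (C.alg.smul_mem (sub_mem (one_mem _) hpC) _) (C.alg.smul_mem hpC _)
    obtain ⟨p', x', y', -, -, -, -, hz, -⟩ := exists_projection (hno C hle)
    have hs := compContinuousMap_surjective (incl hle) (incl_injective hle)
    obtain ⟨X, rfl⟩ := hs x
    obtain ⟨Y, rfl⟩ := hs y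
    have hX : X ⟨p, hpC⟩ = 0 := hx
    have hY : Y ⟨p, hpC⟩ = 1 := hy
    have hXY : X ≠ Y := by
      rintro rfl
      exact zero_ne_one (hX.symm.trans hY)
    have hall : ∀ l : C.Spec, l = X ∨ l = Y := by
      intro l
      have h1 := hz X
      have h2 := hz Y
      have h3 := hz l
      grind
    have : (⟨h, hhC⟩ : C.alg) = X ⟨h, hhC⟩ • (1 - ⟨p, hpC⟩) + Y ⟨h, hhC⟩ • ⟨p, hpC⟩ := by
      refine spec_ext fun l => ?_
      simp only [map_add, map_smul, map_sub, map_one, smul_eq_mul]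
      rcases hall l with rfl | rfl
      · rw [hX, sub_zero, mul_one, mul_zero, add_zero]
      · rw [hY, sub_self, mul_one, mul_zero, zero_add]
    exact ⟨_, _, congrArg Subtype.val this⟩
  -- To be used for `p` and `1 - p`: compressions to a corner commute with `p`, so `key` applies to
  -- the self-adjoint ones.
  have corner : ∀ q : A, q * q = q → star q = q → Commute (p : A) q →
      (∀ α β : ℂ, ∃ c : ℂ, q * (α • (1 - (p : A)) + β • (p : A)) * q = c • q) →
      (∀ b, Commute (p : A) (q * b * q)) → ∀ a, ∃ c : ℂ, q * a * q = c • q := by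
    intro q hq hqs hpq hcomp hcomm a
    have sa : ∀ b : selfAdjoint A, ∃ c : ℂ, q * b * q = c • q := by
      intro b
      have hb : star (b : A) = b := b.2
      obtain ⟨α, β, e⟩ := key (q * b * q) (by
        rw [IsSelfAdjoint, star_mul, star_mul, hqs, hb, mul_assoc]) (hcomm b)
      obtain ⟨c, hc⟩ := hcomp α β
      refine ⟨c, ?_⟩
      rw [← hc, ← e]
      simp only [mul_assoc, hq]
      simp only [← mul_assoc, hq]
    obtain ⟨c, hc⟩ := sa (realPart a)
    obtain ⟨d, hd⟩ := sa (imaginaryPart a)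
    refine ⟨c + Complex.I * d, ?_⟩
    conv_lhs => rw [← realPart_add_I_smul_imaginaryPart a]
    rw [mul_add, add_mul, hc, mul_smul_comm, smul_mul_assoc, hd, add_smul, smul_smul]
  rcases nonempty_starAlgEquiv_of_corners hp' hps' hp0 hp1
    (corner p hp' hps' (.refl _) (fun α β => ⟨β, by
      simp only [mul_add, mul_smul_comm, smul_mul_assoc, hpq, hp', smul_zero, zero_add]⟩) (fun b => by
      rw [Commute, SemiconjBy, mul_assoc _ (p : A) p, hp', ← mul_assoc, ← mul_assoc, hp']))
    (corner (1 - p) hq hqs ((Commute.one_right _).sub_right (.refl _)) (fun α β => ⟨α, by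
      simp only [mul_add, mul_smul_comm, smul_mul_assoc, hqp, hq, smul_zero, add_zero]⟩) (fun b => by
      rw [Commute, SemiconjBy, mul_assoc _ (1 - (p : A)) p, hqp, mul_zero, ← mul_assoc,
        ← mul_assoc, hpq, zero_mul, zero_mul])) with ⟨⟨e⟩⟩ | ⟨⟨e⟩⟩
  · exact hA₁.false e
  · exact hA₂.false (e.trans Matrix.toEuclideanCLM)

end Corners

/-! ### Quasi-Jordan homomorphisms -/

section QuasiJordan

variable {A B : Type u} [CStarAlgebra A] [CStarAlgebra B]

theorem coe_jordanMul (a b : selfAdjoint A) :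
    (jordanMul a b : A) = (2⁻¹ : ℝ) • ((a : A) * b + b * a) := rfl

theorem coe_jordanMul_of_commute {a b : selfAdjoint A} (h : Commute (a : A) b) :
    (jordanMul a b : A) = a * b := by
  rw [coe_jordanMul, ← h.eq, ← two_smul ℝ, smul_smul]
  norm_num

theorem jordanMul_mem (C : Context A) {a b : selfAdjoint A} (ha : (a : A) ∈ C.alg)
    (hb : (b : A) ∈ C.alg) : (jordanMul a b : A) ∈ C.alg := by
  rw [coe_jordanMul_of_commute (C.2.2 a ha b hb)]
  exact mul_mem ha hb

theorem realPart_coe_add_I_smul (u v : selfAdjoint A) :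
    realPart ((u : A) + Complex.I • (v : A)) = u := by
  rw [map_add, realPart_I_smul, v.2.imaginaryPart, neg_zero, add_zero]
  exact Subtype.ext u.2.coe_realPart

theorem imaginaryPart_coe_add_I_smul (u v : selfAdjoint A) :
    imaginaryPart ((u : A) + Complex.I • (v : A)) = v := by
  rw [map_add, imaginaryPart_I_smul, u.2.imaginaryPart, zero_add]
  exact Subtype.ext v.2.coe_realPart

theorem coe_add_I_smul_inj {u v u' v' : selfAdjoint A}
    (h : (u : A) + Complex.I • (v : A) = u' + Complex.I • (v' : A)) : u = u' ∧ v = v' :=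
  ⟨by rw [← realPart_coe_add_I_smul u v, h, realPart_coe_add_I_smul],
    by rw [← imaginaryPart_coe_add_I_smul u v, h, imaginaryPart_coe_add_I_smul]⟩

/-- A self-adjoint element `x` such that `y` and `y²` satisfy `[x, [x, ·]] = 0` commutes
with the self-adjoint element `y`. -/
theorem commute_of_double_commutator {x y : A} (hx : IsSelfAdjoint x) (hy : IsSelfAdjoint y)
    (h1 : x * x * y + y * (x * x) = x * y * x + x * y * x)
    (h2 : x * x * (y * y) + y * y * (x * x) = x * (y * y) * x + x * (y * y) * x) :
    Commute x y := by
  -- For the derivation `δ = [x, ·]`, the Leibniz rule gives `δ²(y²) = δ²(y) y + 2 δ(y)² + y δ²(y)`,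
  -- and the hypotheses say that `δ²` kills `y` and `y²`.
  have hd : (2 : ℂ) • ((x * y - y * x) * (x * y - y * x)) = 0 := by
    have e1 := congrArg (· * y) h1
    have e2 := congrArg (y * ·) h1
    simp only [mul_add, add_mul] at e1 e2
    have : (2 : ℂ) • ((x * y - y * x) * (x * y - y * x)) =
        (x * y * x * y + x * y * x * y - (x * x * y * y + y * (x * x) * y)) +
        (y * (x * y * x) + y * (x * y * x) - (y * (x * x * y) + y * (y * (x * x)))) +
        (x * x * (y * y) + y * y * (x * x) - (x * (y * y) * x + x * (y * y) * x)) := by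
      rw [two_smul]
      noncomm_ring
    rw [this, ← e1, ← e2, h2]
    simp
  have hd' := (smul_eq_zero.1 hd).resolve_left two_ne_zero
  -- The commutator is skew-adjoint with square zero, so it vanishes by the C*-identity.
  have hs : star (x * y - y * x) = -(x * y - y * x) := by
    rw [star_sub, star_mul, star_mul, hx.star_eq, hy.star_eq, neg_sub]
  have : star (x * y - y * x) * (x * y - y * x) = 0 := by
    rw [hs, neg_mul, hd', neg_zero]
  exact sub_eq_zero.1 (CStarRing.star_mul_self_eq_zero_iff _ |>.1 this)

namespace IsQuasiJordanHom

variable {Q : selfAdjoint A → selfAdjoint B}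

theorem map_zero (hQ : IsQuasiJordanHom Q) : Q 0 = 0 := by
  obtain ⟨C, hC⟩ := Context.exists_mem (A := A) (x := 0) inferInstance
  have := hQ.map_smul C 0 0 hC
  rwa [zero_smul, zero_smul] at this

theorem map_neg (hQ : IsQuasiJordanHom Q) (C : Context A) {a : selfAdjoint A}
    (ha : (a : A) ∈ C.alg) : Q (-a) = -Q a := by
  rw [← neg_one_smul ℝ a, hQ.map_smul C _ a ha, neg_one_smul]

/-- Within a context, `(a ∘ a) ∘ c = a ∘ (a ∘ c)` for the Jordan product. Transported by `Q`, this
says that the double commutator of `Q a` with `Q c` vanishes; it is used for `c = b` and `c = b²`.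
-/
theorem commute (hQ : IsQuasiJordanHom Q) (C : Context A) {a b : selfAdjoint A}
    (ha : (a : A) ∈ C.alg) (hb : (b : A) ∈ C.alg) : Commute (Q a : B) (Q b) := by
  have key : ∀ c : selfAdjoint A, (c : A) ∈ C.alg →
      (Q a : B) * Q a * Q c + Q c * (Q a * Q a) = Q a * Q c * Q a + Q a * Q c * Q a := by
    intro c hc
    have hac := jordanMul_mem C ha hc
    have haa := jordanMul_mem C ha ha
    have e : jordanMul (jordanMul a a) c = jordanMul a (jordanMul a c) := by
      ext
      rw [coe_jordanMul_of_commute (C.2.2 _ haa _ hc), coe_jordanMul_of_commute (C.2.2 _ ha _ hac),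
        coe_jordanMul_of_commute (C.2.2 _ ha _ ha), coe_jordanMul_of_commute (C.2.2 _ ha _ hc),
        mul_assoc]
    have h := congrArg Q e
    rw [hQ.map_jordanMul C _ _ haa hc, hQ.map_jordanMul C _ _ ha ha,
      hQ.map_jordanMul C _ _ ha hac, hQ.map_jordanMul C _ _ ha hc] at h
    have h' := congrArg (fun z : selfAdjoint B => (4 : ℝ) • (z : B)) h
    simp only [coe_jordanMul] at h'
    have l1 : (4 : ℝ) • (2⁻¹ : ℝ) • ((2⁻¹ : ℝ) • ((Q a : B) * Q a + Q a * Q a) * Q c +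
        Q c * (2⁻¹ : ℝ) • ((Q a : B) * Q a + Q a * Q a)) =
        (2 : ℝ) • ((Q a : B) * Q a * Q c + Q c * (Q a * Q a)) := by
      rw [← two_smul ℝ, smul_smul (2⁻¹ : ℝ) 2]
      norm_num [smul_smul]
    have l2 : (4 : ℝ) • (2⁻¹ : ℝ) • ((Q a : B) * (2⁻¹ : ℝ) • ((Q a : B) * Q c + Q c * Q a) +
        (2⁻¹ : ℝ) • ((Q a : B) * Q c + Q c * Q a) * Q a) =
        ((Q a : B) * Q a * Q c + Q c * (Q a * Q a)) + (Q a * Q c * Q a + Q a * Q c * Q a) := by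
      rw [mul_smul_comm, smul_mul_assoc, ← smul_add, smul_smul, smul_smul]
      norm_num
      noncomm_ring
    rw [l1, l2, two_smul] at h'
    exact add_left_cancel h'
  refine commute_of_double_commutator (Q a).2 (Q b).2 (key b hb) ?_
  have := key (jordanMul b b) (jordanMul_mem C hb hb)
  rwa [hQ.map_jordanMul C _ _ hb hb, coe_jordanMul_of_commute (.refl _)] at this

theorem map_mul (hQ : IsQuasiJordanHom Q) (C : Context A) {a b c : selfAdjoint A}
    (ha : (a : A) ∈ C.alg) (hb : (b : A) ∈ C.alg) (h : (c : A) = a * b) :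
    (Q c : B) = Q a * Q b := by
  have : c = jordanMul a b :=
    Subtype.ext (h.trans (coe_jordanMul_of_commute (C.2.2 _ ha _ hb)).symm)
  rw [this, hQ.map_jordanMul C _ _ ha hb, coe_jordanMul_of_commute (hQ.commute C ha hb)]

/-- The complex-linear extension of a quasi-Jordan homomorphism to a context, as a function on the
whole algebra. -/
def extend (Q : selfAdjoint A → selfAdjoint B) (a : A) : B :=
  (Q (realPart a) : B) + Complex.I • (Q (imaginaryPart a) : B)

theorem extend_coe_add_I_smul (u v : selfAdjoint A) :
    extend Q ((u : A) + Complex.I • (v : A)) = Q u + Complex.I • (Q v : B) := by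
  rw [extend, realPart_coe_add_I_smul, imaginaryPart_coe_add_I_smul]

theorem extend_coe (hQ : IsQuasiJordanHom Q) (a : selfAdjoint A) : extend Q (a : A) = Q a := by
  have := extend_coe_add_I_smul (Q := Q) a 0
  rwa [ZeroMemClass.coe_zero, smul_zero, add_zero, hQ.map_zero, ZeroMemClass.coe_zero, smul_zero,
    add_zero] at this

theorem realPart_extend (a : A) : realPart (extend Q a) = Q (realPart a) :=
  realPart_coe_add_I_smul _ _

theorem imaginaryPart_extend (a : A) : imaginaryPart (extend Q a) = Q (imaginaryPart a) :=
  imaginaryPart_coe_add_I_smul _ _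

theorem extend_add (hQ : IsQuasiJordanHom Q) (C : Context A) {a b : A} (ha : a ∈ C.alg)
    (hb : b ∈ C.alg) : extend Q (a + b) = extend Q a + extend Q b := by
  rw [extend, _root_.map_add, _root_.map_add,
    hQ.map_add C _ _ (Context.realPart_mem _ ha) (Context.realPart_mem _ hb),
    hQ.map_add C _ _ (Context.imaginaryPart_mem _ ha) (Context.imaginaryPart_mem _ hb)]
  simp only [AddSubgroup.coe_add, smul_add, extend]
  abel

theorem extend_mul (hQ : IsQuasiJordanHom Q) (C : Context A) {a b : A} (ha : a ∈ C.alg)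
    (hb : b ∈ C.alg) : extend Q (a * b) = extend Q a * extend Q b := by
  have hx := Context.realPart_mem _ ha
  have hy := Context.imaginaryPart_mem _ ha
  have hx' := Context.realPart_mem _ hb
  have hy' := Context.imaginaryPart_mem _ hb
  have ea := realPart_add_I_smul_imaginaryPart a
  have eb := realPart_add_I_smul_imaginaryPart b
  have exa : extend Q a = Q (realPart a) + Complex.I • (Q (imaginaryPart a) : B) := rfl
  have exb : extend Q b = Q (realPart b) + Complex.I • (Q (imaginaryPart b) : B) := rfl
  rw [exa, exb]
  set x := realPart a
  set y := imaginaryPart a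
  set x' := realPart b
  set y' := imaginaryPart b
  have m1 := jordanMul_mem C hx hx'
  have m2 := jordanMul_mem C hy hy'
  have m3 := jordanMul_mem C hx hy'
  have m4 := jordanMul_mem C hy hx'
  have m2' : ((-jordanMul y y' : selfAdjoint A) : A) ∈ C.alg := neg_mem m2
  have e : a * b = ((jordanMul x x' + -jordanMul y y' : selfAdjoint A) : A) +
      Complex.I • ((jordanMul x y' + jordanMul y x' : selfAdjoint A) : A) := by
    simp only [AddSubgroup.coe_add, NegMemClass.coe_neg]
    rw [coe_jordanMul_of_commute (C.2.2 _ hx _ hx'), coe_jordanMul_of_commute (C.2.2 _ hy _ hy'),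
      coe_jordanMul_of_commute (C.2.2 _ hx _ hy'), coe_jordanMul_of_commute (C.2.2 _ hy _ hx'),
      ← ea, ← eb]
    simp only [mul_add, add_mul, smul_add, smul_mul_assoc, mul_smul_comm, smul_smul,
      Complex.I_mul_I, neg_one_smul]
    abel
  rw [e, extend_coe_add_I_smul, hQ.map_add C _ _ m1 m2', hQ.map_add C _ _ m3 m4,
    hQ.map_neg C m2]
  simp only [AddSubgroup.coe_add, NegMemClass.coe_neg]
  rw [hQ.map_mul C hx hx' (coe_jordanMul_of_commute (C.2.2 _ hx _ hx')),
    hQ.map_mul C hy hy' (coe_jordanMul_of_commute (C.2.2 _ hy _ hy')),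
    hQ.map_mul C hx hy' (coe_jordanMul_of_commute (C.2.2 _ hx _ hy')),
    hQ.map_mul C hy hx' (coe_jordanMul_of_commute (C.2.2 _ hy _ hx'))]
  simp only [mul_add, add_mul, smul_add, smul_mul_assoc, mul_smul_comm, smul_smul,
    Complex.I_mul_I, neg_one_smul]
  abel

theorem extend_smul_one (hQ : IsQuasiJordanHom Q) (z : ℂ) :
    extend Q (z • (1 : A)) = z • (1 : B) := by
  obtain ⟨C, hC⟩ := Context.exists_mem (A := A) (x := 1) inferInstance
  have e : ∀ (D : Type u) [CStarAlgebra D], z • (1 : D) = ((z.re • (1 : selfAdjoint D) :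
      selfAdjoint D) : D) + Complex.I • ((z.im • (1 : selfAdjoint D) : selfAdjoint D) : D) := by
    intro D _
    conv_lhs => rw [← Complex.re_add_im z]
    simp only [selfAdjoint.val_smul, selfAdjoint.val_one, ← Complex.coe_smul, smul_smul, add_smul,
      mul_comm]
  rw [e A, extend_coe_add_I_smul, hQ.map_smul C _ _ hC, hQ.map_smul C _ _ hC, hQ.map_one, ← e B]

theorem extend_star (hQ : IsQuasiJordanHom Q) (C : Context A) {a : A} (ha : a ∈ C.alg) :
    extend Q (star a) = star (extend Q a) := by
  have e : star a = (realPart a : A) + Complex.I • ((-imaginaryPart a : selfAdjoint A) : A) := by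
    conv_lhs => rw [← realPart_add_I_smul_imaginaryPart a]
    have h1 : star (realPart a : A) = realPart a := (realPart a).2
    have h2 : star (imaginaryPart a : A) = imaginaryPart a := (imaginaryPart a).2
    simp [h1, h2]
  have h1 : star (Q (realPart a) : B) = Q (realPart a) := (Q (realPart a)).2
  have h2 : star (Q (imaginaryPart a) : B) = Q (imaginaryPart a) := (Q (imaginaryPart a)).2
  rw [e, extend_coe_add_I_smul, hQ.map_neg C (Context.imaginaryPart_mem _ ha), extend]
  simp [h1, h2]

/-- The complex-linear extension of a quasi-Jordan homomorphism to a context. -/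
def starAlgHom (hQ : IsQuasiJordanHom Q) (C : Context A) : C.alg →⋆ₐ[ℂ] B where
  toFun a := extend Q (a : A)
  map_one' := by
    have := hQ.extend_smul_one 1
    rwa [one_smul, one_smul] at this
  map_mul' a b := hQ.extend_mul C a.2 b.2
  map_zero' := by
    have := hQ.extend_smul_one 0
    rwa [zero_smul, zero_smul] at this
  map_add' a b := hQ.extend_add C a.2 b.2
  commutes' z := by
    have := hQ.extend_smul_one z
    rwa [← Algebra.algebraMap_eq_smul_one, ← Algebra.algebraMap_eq_smul_one] at this
  map_star' a := hQ.extend_star C a.2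

theorem starAlgHom_coe (hQ : IsQuasiJordanHom Q) (C : Context A) (a : selfAdjoint A)
    (ha : (a : A) ∈ C.alg) : hQ.starAlgHom C ⟨a, ha⟩ = Q a := hQ.extend_coe a

theorem extend_injective (hi : Function.Injective Q) : Function.Injective (extend Q) := by
  intro a b h
  obtain ⟨h1, h2⟩ := coe_add_I_smul_inj h
  rw [← realPart_add_I_smul_imaginaryPart a, hi h1, hi h2, realPart_add_I_smul_imaginaryPart b]

theorem extend_extend {R : selfAdjoint B → selfAdjoint A} (h : ∀ a, R (Q a) = a) (a : A) :
    extend R (extend Q a) = a := by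
  rw [extend, realPart_extend, imaginaryPart_extend, h, h, realPart_add_I_smul_imaginaryPart]

/-- The inverse of a bijective quasi-Jordan homomorphism is one if it maps contexts into
contexts. -/
theorem symm {e : selfAdjoint A ≃ selfAdjoint B} (h : IsQuasiJordanHom e)
    (hC : ∀ C' : Context B, ∃ C : Context A, ∀ b : selfAdjoint B, (b : B) ∈ C'.alg →
      (e.symm b : A) ∈ C.alg) : IsQuasiJordanHom e.symm := by
  refine ⟨by rw [e.symm_apply_eq, h.map_one], ?_, ?_, ?_⟩
  · intro C' a b ha hb
    obtain ⟨C, hC⟩ := hC C'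
    rw [e.symm_apply_eq, h.map_add C _ _ (hC a ha) (hC b hb), e.apply_symm_apply,
      e.apply_symm_apply]
  · intro C' r a ha
    obtain ⟨C, hC⟩ := hC C'
    rw [e.symm_apply_eq, h.map_smul C _ _ (hC a ha), e.apply_symm_apply]
  · intro C' a b ha hb
    obtain ⟨C, hC⟩ := hC C'
    rw [e.symm_apply_eq, h.map_jordanMul C _ _ (hC a ha) (hC b hb), e.apply_symm_apply,
      e.apply_symm_apply]

end IsQuasiJordanHom

/-! ### The action of quasi-Jordan isomorphisms on contexts -/

namespace QuasiJordanIso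

theorem ext_apply {Q R : QuasiJordanIso A B} (h : ∀ a, Q.toEquiv a = R.toEquiv a) : Q = R := by
  obtain ⟨e, _, _⟩ := Q
  obtain ⟨f, _, _⟩ := R
  obtain rfl : e = f := Equiv.ext h
  rfl

/-- The inverse quasi-Jordan isomorphism. -/
def symm (Q : QuasiJordanIso A B) : QuasiJordanIso B A := ⟨Q.toEquiv.symm, Q.inv, Q.hom⟩

/-- The complex-linear extension of a quasi-Jordan isomorphism to a context. -/
def starAlgHom (Q : QuasiJordanIso A B) (C : Context A) : C.alg →⋆ₐ[ℂ] B := Q.hom.starAlgHom C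

theorem starAlgHom_injective (Q : QuasiJordanIso A B) (C : Context A) :
    Function.Injective (Q.starAlgHom C) := fun _ _ h =>
  Subtype.ext (IsQuasiJordanHom.extend_injective Q.toEquiv.injective h)

/-- The image of a context under a quasi-Jordan isomorphism. -/
def mapContext (Q : QuasiJordanIso A B) (C : Context A) : Context B :=
  ⟨(Q.starAlgHom C).range, by
    change IsClosed (Set.range (Q.starAlgHom C))
    -- An injective star-homomorphism of C*-algebras is isometric, so its range is closed.
    exact (NonUnitalStarAlgHom.isometry (Q.starAlgHom C)
      (Q.starAlgHom_injective C)).isClosedEmbedding.isClosed_range, by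
    rintro _ ⟨a, rfl⟩ _ ⟨b, rfl⟩
    exact (Commute.all a b).map (Q.starAlgHom C)⟩

theorem mem_mapContext (Q : QuasiJordanIso A B) (C : Context A) (b : selfAdjoint B) :
    (b : B) ∈ (Q.mapContext C).alg ↔ (Q.toEquiv.symm b : A) ∈ C.alg := by
  constructor
  · rintro ⟨a, ha⟩
    have : b = Q.toEquiv (realPart (a : A)) := by
      rw [← IsQuasiJordanHom.realPart_extend (Q := Q.toEquiv)]
      refine Subtype.ext ?_
      rw [← b.2.coe_realPart]
      exact congrArg (fun c => ((realPart c : selfAdjoint B) : B)) ha.symm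
    rw [this, Equiv.symm_apply_apply]
    exact Context.realPart_mem _ a.2
  · intro h
    refine ⟨⟨_, h⟩, ?_⟩
    refine (Q.hom.starAlgHom_coe C _ h).trans ?_
    rw [Q.toEquiv.apply_symm_apply]

/-- The order-isomorphism of context categories induced by a quasi-Jordan isomorphism. -/
def orderIso (Q : QuasiJordanIso A B) : Context A ≃o Context B where
  toFun := Q.mapContext
  invFun := Q.symm.mapContext
  left_inv C := Context.ext_of_selfAdjoint fun a => by
    rw [mem_mapContext, mem_mapContext]
    change (Q.toEquiv.symm (Q.toEquiv a) : A) ∈ C.alg ↔ _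
    rw [Equiv.symm_apply_apply]
  right_inv C := Context.ext_of_selfAdjoint fun a => by
    rw [mem_mapContext, mem_mapContext]
    change (Q.toEquiv (Q.toEquiv.symm a) : B) ∈ C.alg ↔ _
    rw [Equiv.apply_symm_apply]
  map_rel_iff' {C D} := by
    constructor
    · intro h
      refine Context.le_of_selfAdjoint fun a ha => ?_
      have := @h (Q.toEquiv a) ((Q.mem_mapContext C _).2 (by rwa [Equiv.symm_apply_apply]))
      replace this := (Q.mem_mapContext D _).1 this
      rwa [Equiv.symm_apply_apply] at this
    · intro h
      exact Context.le_of_selfAdjoint fun b hb =>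
        (Q.mem_mapContext D b).2 (h ((Q.mem_mapContext C b).1 hb))

theorem corrOrder_orderIso (Q : QuasiJordanIso A B) : Q.CorrOrder Q.orderIso := fun C a => by
  refine (Q.mem_mapContext C _).trans ?_
  rw [Equiv.symm_apply_apply]

theorem CorrOrder.unique {Q : QuasiJordanIso A B} {γ δ : Context A ≃o Context B}
    (hγ : Q.CorrOrder γ) (hδ : Q.CorrOrder δ) : γ = δ := by
  refine OrderIso.ext (funext fun C => Context.ext_of_selfAdjoint fun b => ?_)
  obtain ⟨a, rfl⟩ := Q.toEquiv.surjective b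
  exact (hγ C a).trans (hδ C a).symm

/-- This lets `Implements.unique` compare two quasi-Jordan isomorphisms over the same `γ`. -/
theorem CorrOrder.implements {Q : QuasiJordanIso A B} {γ : Context A ≃o Context B}
    (h : Q.CorrOrder γ) (C : Context A) : Context.Implements γ C (Q.starAlgHom C) := by
  refine ⟨Q.starAlgHom_injective C, fun D hD b => ?_⟩
  have hb : ∀ c : selfAdjoint B, (c : B) ∈ (γ D).alg ↔ (Q.toEquiv.symm c : A) ∈ D.alg := by
    intro c
    rw [← h D, Equiv.apply_symm_apply]
  constructor
  · intro hbD
    have m : IsQuasiJordanHom.extend Q.toEquiv.symm b ∈ D.alg :=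
      add_mem ((hb _).1 (Context.realPart_mem _ hbD))
        (D.alg.smul_mem ((hb _).1 (Context.imaginaryPart_mem _ hbD)) _)
    exact ⟨⟨_, hD m⟩, m, IsQuasiJordanHom.extend_extend Q.toEquiv.apply_symm_apply b⟩
  · rintro ⟨a, ha, rfl⟩
    exact add_mem ((h D _).2 (Context.realPart_mem _ ha))
      ((γ D).alg.smul_mem ((h D _).2 (Context.imaginaryPart_mem _ ha)) _)

end QuasiJordanIso

/-- A cofinal coherent family of implementing homomorphisms glues to a quasi-Jordan
isomorphism. -/
theorem exists_quasiJordanIso_of_implements (γ : Context A ≃o Context B) (P : Context A → Prop)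
    (hP : ∀ C₀, ∃ C, C₀ ≤ C ∧ P C) (κ : ∀ C, P C → C.alg →⋆ₐ[ℂ] B)
    (hκ : ∀ C hC, Context.Implements γ C (κ C hC))
    (hcoh : ∀ C C' hC hC' (a : A) (ha : a ∈ C.alg) (ha' : a ∈ C'.alg),
      κ C hC ⟨a, ha⟩ = κ C' hC' ⟨a, ha'⟩) :
    ∃ Q : QuasiJordanIso A B, Q.CorrOrder γ ∧ ∀ C hC (a : selfAdjoint A) (ha : (a : A) ∈ C.alg),
      κ C hC ⟨a, ha⟩ = Q.toEquiv a := by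
  have hE : ∀ a : selfAdjoint A, ∃ C, P C ∧ (a : A) ∈ C.alg := by
    intro a
    obtain ⟨C₀, h₀⟩ := Context.exists_mem (x := (a : A)) inferInstance
    obtain ⟨C, hC, hPC⟩ := hP C₀
    exact ⟨C, hPC, hC h₀⟩
  choose E hEP hEa using hE
  have hsa : ∀ C hC (a : C.alg), IsSelfAdjoint (a : A) ↔ IsSelfAdjoint (κ C hC a) := by
    intro C hC a
    rw [IsSelfAdjoint, IsSelfAdjoint, ← map_star, (hκ C hC).injective.eq_iff, Subtype.ext_iff]
    rfl
  -- The context `E a` is an arbitrary choice; `hcoh` makes the value independent of it.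
  let q : selfAdjoint A → selfAdjoint B := fun a =>
    ⟨κ (E a) (hEP a) ⟨a, hEa a⟩, (hsa _ _ _).1 a.2⟩
  have hq : ∀ C hC (a : selfAdjoint A) (ha : (a : A) ∈ C.alg), κ C hC ⟨a, ha⟩ = q a :=
    fun C hC a ha => hcoh _ _ _ _ _ _ _
  have hmem : ∀ C (hC : P C) D (a : selfAdjoint A), (a : A) ∈ C.alg → D ≤ C →
      ((q a : B) ∈ (γ D).alg ↔ (a : A) ∈ D.alg) := by
    intro C hC D a ha hD
    rw [← hq C hC a ha]
    exact (hκ C hC).apply_mem_iff hD ⟨a, ha⟩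
  have hinj : Function.Injective q := by
    intro a b h
    have h1 : (q a : B) ∈ (γ (E a)).alg := (hmem _ (hEP a) _ a (hEa a) le_rfl).2 (hEa a)
    have h2 : (q a : B) ∈ (γ (E b)).alg := by
      rw [h]
      exact (hmem _ (hEP b) _ b (hEa b) le_rfl).2 (hEa b)
    -- The common value lies over both chosen contexts, hence over their intersection. This puts `a`
    -- into `E b`, where `κ` is injective.
    have h3 : (q a : B) ∈ (γ ((E a).inter (E b))).alg := by
      rw [Context.map_inter]
      exact ⟨h1, h2⟩
    have h4 := (hmem _ (hEP a) _ a (hEa a) (Context.inter_le_left _ _)).1 h3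
    have h5 : κ (E b) (hEP b) ⟨a, h4.2⟩ = κ (E b) (hEP b) ⟨b, hEa b⟩ := by
      rw [hq, hq, h]
    exact Subtype.ext (congrArg (Subtype.val : (E b).alg → A) ((hκ _ (hEP b)).injective h5))
  have hback : ∀ D (b : selfAdjoint B), (b : B) ∈ (γ D).alg →
      ∃ a : selfAdjoint A, (a : A) ∈ D.alg ∧ q a = b := by
    intro D b hb
    obtain ⟨C, hDC, hC⟩ := hP D
    obtain ⟨a, ha, e⟩ := ((hκ C hC).mem_iff D hDC b).1 hb
    have hs : IsSelfAdjoint (a : A) := (hsa C hC a).2 (by rw [e]; exact b.2)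
    exact ⟨⟨a, hs⟩, ha, Subtype.ext ((hq C hC ⟨a, hs⟩ a.2).symm.trans e)⟩
  have hsurj : Function.Surjective q := by
    intro b
    obtain ⟨D', hb⟩ := Context.exists_mem (x := (b : B)) inferInstance
    obtain ⟨a, -, ha⟩ := hback (γ.symm D') b (by rwa [γ.apply_symm_apply])
    exact ⟨a, ha⟩
  have hcorr : ∀ D (a : selfAdjoint A), (q a : B) ∈ (γ D).alg ↔ (a : A) ∈ D.alg := by
    intro D a
    constructor
    · intro h
      obtain ⟨a', ha', e⟩ := hback D _ h
      rwa [← hinj e]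
    · intro h
      obtain ⟨C, hDC, hC⟩ := hP D
      exact (hmem C hC D a (hDC h) hDC).2 h
  have hhom : IsQuasiJordanHom q := by
    refine ⟨?_, fun D a b ha hb => ?_, fun D r a ha => ?_, fun D a b ha hb => ?_⟩
    · refine Subtype.ext ((hq (E 1) (hEP 1) 1 (hEa 1)).symm.trans ?_)
      exact map_one (κ (E 1) (hEP 1))
    · obtain ⟨C, hDC, hC⟩ := hP D
      refine Subtype.ext ((hq C hC (a + b) (add_mem (hDC ha) (hDC hb))).symm.trans ?_)
      exact (map_add (κ C hC) ⟨a, hDC ha⟩ ⟨b, hDC hb⟩).trans (by rw [hq, hq])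
    · obtain ⟨C, hDC, hC⟩ := hP D
      have e : ((r • a : selfAdjoint A) : A) = (r : ℂ) • (a : A) := by
        rw [selfAdjoint.val_smul, Complex.coe_smul]
      have m : ((r • a : selfAdjoint A) : A) ∈ C.alg := by
        rw [e]
        exact C.alg.smul_mem (hDC ha) _
      refine Subtype.ext ((hq C hC (r • a) m).symm.trans ?_)
      have e' : (⟨(r • a : selfAdjoint A), m⟩ : C.alg) = (r : ℂ) • ⟨a, hDC ha⟩ := Subtype.ext e
      rw [e', map_smul, hq, Complex.coe_smul]
      rfl
    · obtain ⟨C, hDC, hC⟩ := hP D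
      have ha' := hDC ha
      have hb' := hDC hb
      have hcomm : Commute (q a : B) (q b) := by
        rw [← hq C hC a ha', ← hq C hC b hb']
        exact (Commute.all _ _).map _
      refine Subtype.ext ((hq C hC _ (jordanMul_mem C ha' hb')).symm.trans ?_)
      rw [coe_jordanMul_of_commute hcomm, ← hq C hC a ha', ← hq C hC b hb', ← map_mul]
      exact congrArg _ (Subtype.ext (coe_jordanMul_of_commute (C.2.2 _ ha' _ hb')))
  let e : selfAdjoint A ≃ selfAdjoint B := Equiv.ofBijective q ⟨hinj, hsurj⟩
  refine ⟨⟨e, hhom, IsQuasiJordanHom.symm (e := e) hhom fun C' => ⟨γ.symm C', fun b hb => ?_⟩⟩,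
    hcorr, hq⟩
  refine (hcorr _ _).1 ?_
  rw [γ.apply_symm_apply]
  have : q (e.symm b) = b := e.apply_symm_apply b
  rwa [this]

end QuasiJordan

/-! ### Order-isomorphisms and quasi-Jordan isomorphisms -/

section Order

variable {A B : Type u} [CStarAlgebra A] [CStarAlgebra B]

theorem isBijectiveCorrespondence_order [Nontrivial A] [Nontrivial B]
    (hA₁ : IsEmpty (A ≃⋆ₐ[ℂ] (ℂ × ℂ)))
    (hA₂ : IsEmpty (A ≃⋆ₐ[ℂ] (EuclideanSpace ℂ (Fin 2) →L[ℂ] EuclideanSpace ℂ (Fin 2)))) :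
    IsBijectiveCorrespondence
      (fun (γ : Context A ≃o Context B) (Q : QuasiJordanIso A B) => Q.CorrOrder γ) := by
  refine ⟨fun γ => ?_, fun Q => ⟨Q.orderIso, Q.corrOrder_orderIso, fun δ hδ =>
    hδ.unique Q.corrOrder_orderIso⟩⟩
  have hex := fun C (hC : Context.Good C) => Context.exists_implements γ hC
  choose κ hκ using hex
  -- Cofinality of good contexts is where the exceptional algebras are excluded.
  obtain ⟨Q, hQ, -⟩ := exists_quasiJordanIso_of_implements γ Context.Good
    (Context.exists_good_ge hA₁ hA₂) κ hκ
    fun C C' hC hC' a ha ha' => (hκ C hC).coherent hC hC' (hκ C' hC') ha ha'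
  refine ⟨Q, hQ, fun R hR => QuasiJordanIso.ext_apply fun a => ?_⟩
  obtain ⟨C₀, h₀⟩ := Context.exists_mem (x := (a : A)) inferInstance
  obtain ⟨C, hC, hg⟩ := Context.exists_good_ge hA₁ hA₂ C₀
  have e := DFunLike.congr_fun ((hR.implements C).unique hg (hQ.implements C)) ⟨a, hC h₀⟩
  exact Subtype.ext ((R.hom.starAlgHom_coe C a _).symm.trans
    (e.trans (Q.hom.starAlgHom_coe C a _)))

end Order

/-! ### Isomorphisms of Bohrifications -/

section Bohrification

variable {A B : Type u} [CStarAlgebra A] [CStarAlgebra B]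

/-- A *-isomorphism as an isomorphism in the category of unital abelian C*-algebras. -/
def UCommCStar.isoOfEquiv {X Y : UCommCStar.{u}} (φ : X.carrier ≃⋆ₐ[ℂ] Y.carrier) : X ≅ Y where
  hom := (⟨(φ : X.carrier →⋆ₐ[ℂ] Y.carrier)⟩ : UCommCStarHom X Y)
  inv := (⟨(φ.symm : Y.carrier →⋆ₐ[ℂ] X.carrier)⟩ : UCommCStarHom Y X)
  hom_inv_id := congrArg UCommCStarHom.mk (StarAlgHom.ext φ.symm_apply_apply)
  inv_hom_id := congrArg UCommCStarHom.mk (StarAlgHom.ext φ.apply_symm_apply)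

theorem UCommCStar.hom_inv_apply {X Y : UCommCStar.{u}} (e : X ≅ Y) (a : X.carrier) :
    e.inv.hom (e.hom.hom a) = a :=
  congrArg (fun f : UCommCStarHom X X => f.hom a) e.hom_inv_id

theorem UCommCStar.inv_hom_apply {X Y : UCommCStar.{u}} (e : X ≅ Y) (a : Y.carrier) :
    e.hom.hom (e.inv.hom a) = a :=
  congrArg (fun f : UCommCStarHom Y Y => f.hom a) e.inv_hom_id

/-- The isomorphism of Bohrifications given by a natural family of *-isomorphisms. -/
def CopresheafIso.ofEquiv (γ : Context A ≃o Context B)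
    (φ : ∀ C : Context A, C.alg ≃⋆ₐ[ℂ] (γ C).alg)
    (h : ∀ (C D : Context A) (hD : D ≤ C) (a : D.alg),
      ((φ C (Context.incl hD a) : (γ C).alg) : B) = φ D a) :
    CopresheafIso (bohrification A) (bohrification B) where
  base := γ
  kappa := NatIso.ofComponents
    (fun C => UCommCStar.isoOfEquiv (X := (bohrification A).obj C)
      (Y := ((copresheafInverseImage γ).obj (bohrification B)).obj C) (φ C))
    fun {D C} f => congrArg UCommCStarHom.mk
      (StarAlgHom.ext fun a => Subtype.ext (h C D (leOfHom f) a))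

namespace CopresheafIso

variable (k : CopresheafIso (bohrification A) (bohrification B))

theorem component_incl {C D : Context A} (hD : D ≤ C) (a : D.alg) :
    (k.component C (Context.incl hD a) : B) = k.component D a :=
  congrArg (fun f : UCommCStarHom ⟨D.alg⟩ ⟨(k.base C).alg⟩ => ((f.hom a : (k.base C).alg) : B))
    (k.kappa.hom.naturality (homOfLE hD))

theorem component_bijective (C : Context A) : Function.Bijective (k.component C) :=
  Function.bijective_iff_has_inverse.2 ⟨(k.kappa.app C).inv.hom,
    UCommCStar.hom_inv_apply (k.kappa.app C), UCommCStar.inv_hom_apply (k.kappa.app C)⟩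

/-- By naturality the component at `C` restricts to the component at `D`, which is onto `γ D`. -/
theorem implements_component (C : Context A) :
    Context.Implements k.base C ((k.base C).alg.subtype.comp (k.component C)) := by
  refine ⟨Subtype.val_injective.comp (k.component_bijective C).1, fun D hD b => ?_⟩
  constructor
  · intro hb
    obtain ⟨a, ha⟩ := (k.component_bijective D).2 ⟨b, hb⟩
    exact ⟨Context.incl hD a, a.2, (k.component_incl hD a).trans (congrArg Subtype.val ha)⟩
  · rintro ⟨a, ha, rfl⟩
    have := k.component_incl hD ⟨a, ha⟩
    exact Set.mem_of_eq_of_mem this (k.component D ⟨a, ha⟩).2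

theorem eq_of_component {k k' : CopresheafIso (bohrification A) (bohrification B)}
    (hb : k.base = k'.base) (h : ∀ (C : Context A) (a : C.alg),
      (k.component C a : B) = k'.component C a) : k = k' := by
  obtain ⟨γ, κ⟩ := k
  obtain ⟨γ', κ'⟩ := k'
  obtain rfl : γ = γ' := hb
  congr 1
  ext C
  exact congrArg UCommCStarHom.mk (StarAlgHom.ext fun a => Subtype.ext (h C a))

end CopresheafIso

namespace QuasiJordanIso

variable (Q : QuasiJordanIso A B)

/-- The *-isomorphism from a context onto its image under a quasi-Jordan isomorphism. -/
def contextEquiv (C : Context A) : C.alg ≃⋆ₐ[ℂ] (Q.orderIso C).alg :=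
  StarAlgEquiv.ofInjective (Q.starAlgHom C) (Q.starAlgHom_injective C)

/-- The isomorphism of Bohrifications induced by a quasi-Jordan isomorphism. -/
def bohrIso : CopresheafIso (bohrification A) (bohrification B) :=
  CopresheafIso.ofEquiv Q.orderIso Q.contextEquiv fun _ _ _ _ => rfl

theorem corrBohr_bohrIso : Q.CorrBohr Q.bohrIso := fun C a ha => Q.hom.starAlgHom_coe C a ha

variable {Q}

/-- If `Q a` lies in `γ C`, take any context `C'` containing `a`. Then `Q a` lies in `γ C' ∩ γ C = γ
(C' ∩ C)`, so `a` is in `C`. -/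
theorem CorrBohr.corrOrder {k : CopresheafIso (bohrification A) (bohrification B)}
    (h : Q.CorrBohr k) : Q.CorrOrder k.base := by
  intro C a
  constructor
  · intro hb
    obtain ⟨C', hC'⟩ := Context.exists_mem (x := (a : A)) inferInstance
    rw [← h C' a hC'] at hb
    have hi : (k.component C' ⟨a, hC'⟩ : B) ∈ (k.base (C'.inter C)).alg := by
      rw [Context.map_inter]
      exact ⟨(k.component C' ⟨a, hC'⟩).2, hb⟩
    exact (((k.implements_component C').apply_mem_iff (Context.inter_le_left _ _) _).1 hi).2
  · intro ha
    rw [← h C a ha]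
    exact (k.component C ⟨a, ha⟩).2

theorem CorrBohr.coe_component {k : CopresheafIso (bohrification A) (bohrification B)}
    (h : Q.CorrBohr k) (C : Context A) (a : C.alg) :
    (k.component C a : B) = Q.starAlgHom C a := by
  have e : a = ⟨realPart (a : A), Context.realPart_mem _ a.2⟩ +
      Complex.I • ⟨imaginaryPart (a : A), Context.imaginaryPart_mem _ a.2⟩ :=
    Subtype.ext (realPart_add_I_smul_imaginaryPart (a : A)).symm
  conv_lhs => rw [e]
  rw [map_add, map_smul]
  exact congrArg₂ (fun x y => x + Complex.I • y) (h C _ _) (h C _ _)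

end QuasiJordanIso

theorem isBijectiveCorrespondence_bohr :
    IsBijectiveCorrespondence
      (fun (k : CopresheafIso (bohrification A) (bohrification B)) (Q : QuasiJordanIso A B) =>
        Q.CorrBohr k) := by
  constructor
  · intro k
    -- Here every context carries a homomorphism, and coherence is naturality along the inclusions
    -- of an intersection.
    obtain ⟨Q, -, hQ⟩ := exists_quasiJordanIso_of_implements k.base (fun _ => True)
      (fun C => ⟨C, le_rfl, trivial⟩)
      (fun C _ => (k.base C).alg.subtype.comp (k.component C))
      (fun C _ => k.implements_component C) (fun C C' _ _ a ha ha' =>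
        (k.component_incl (Context.inter_le_left C C') ⟨a, ha, ha'⟩).trans
          (k.component_incl (Context.inter_le_right C C') ⟨a, ha, ha'⟩).symm)
    refine ⟨Q, fun C a ha => hQ C trivial a ha, fun R hR =>
      QuasiJordanIso.ext_apply fun a => ?_⟩
    obtain ⟨C, hC⟩ := Context.exists_mem (x := (a : A)) inferInstance
    exact Subtype.ext ((hR C a hC).symm.trans (hQ C trivial a hC))
  · refine fun Q => ⟨Q.bohrIso, Q.corrBohr_bohrIso, fun k hk => ?_⟩
    refine CopresheafIso.eq_of_component
      (hk.corrOrder.unique Q.corrBohr_bohrIso.corrOrder) fun C a => ?_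
    rw [hk.coe_component, Q.corrBohr_bohrIso.coe_component]

end Bohrification

/-! ### Isomorphisms of spectral presheaves -/

section Spectral

variable {A B : Type u} [CStarAlgebra A] [CStarAlgebra B]

theorem Context.character_ext {C : Context A} {l m : C.Spec} (h : ∀ a, l a = m a) : l = m :=
  DFunLike.ext _ _ h

namespace PresheafIso

/-- The isomorphism of spectral presheaves given by a natural family of homeomorphisms. -/
def ofHomeo (γ : Context A ≃o Context B)
    (f : ∀ C : Context A, (γ C).Spec ≃ₜ C.Spec)
    (h : ∀ (C D : Context A) (hD : D ≤ C) (l : (γ C).Spec) (a : D.alg),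
      f D (WeakDual.CharacterSpace.compContinuousMap (Context.incl (γ.monotone hD)) l) a =
        f C l (Context.incl hD a)) :
    PresheafIso (spectralPresheaf B) (spectralPresheaf A) where
  base := γ
  iota := NatIso.ofComponents (fun C => CompHausLike.isoOfHomeo
      (X := ((presheafInverseImage γ).obj (spectralPresheaf B)).obj C)
      (Y := (spectralPresheaf A).obj C) (f C.unop)) fun {C D} g => by
    refine ConcreteCategory.hom_ext _ _ fun l => ?_
    exact Context.character_ext (C := D.unop) fun a => h C.unop D.unop (leOfHom g.unop) l a

variable (e : PresheafIso (spectralPresheaf B) (spectralPresheaf A))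

theorem component_restrict {C D : Context A} (hD : D ≤ C) (l : (e.base C).Spec) (a : D.alg) :
    e.component D (WeakDual.CharacterSpace.compContinuousMap
      (Context.incl (e.base.monotone hD)) l) a = e.component C l (Context.incl hD a) := by
  have := ConcreteCategory.congr_hom (e.iota.hom.naturality (homOfLE hD).op) l
  exact congrArg (fun m : D.Spec => m a) this

/-- The component of an isomorphism of spectral presheaves as a homeomorphism. -/
def homeo (C : Context A) : (e.base C).Spec ≃ₜ C.Spec :=
  CompHausLike.homeoOfIso (e.iota.app (op C))

theorem homeo_apply (C : Context A) (l : (e.base C).Spec) : e.homeo C l = e.component C l := rfl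

/-- The isomorphism of Bohrifications dual to an isomorphism of spectral presheaves. -/
def toCopresheafIso : CopresheafIso (bohrification A) (bohrification B) :=
  CopresheafIso.ofEquiv e.base (fun C => starAlgEquivOfHomeo (e.homeo C)) fun C D hD a => by
    have : starAlgEquivOfHomeo (e.homeo C) (Context.incl hD a) =
        Context.incl (e.base.monotone hD) (starAlgEquivOfHomeo (e.homeo D) a) := by
      refine Context.spec_ext fun l => ?_
      rw [apply_starAlgEquivOfHomeo, homeo_apply, ← e.component_restrict hD l a]
      exact (apply_starAlgEquivOfHomeo (e.homeo D) a _).symm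
    exact congrArg Subtype.val this

theorem apply_component_toCopresheafIso (C : Context A) (a : C.alg) (l : (e.base C).Spec) :
    l (e.toCopresheafIso.component C a) = e.component C l a :=
  apply_starAlgEquivOfHomeo (e.homeo C) a l

/-- Gelfand duality is faithful, so equality may be tested on the dual isomorphisms of
Bohrifications. -/
theorem eq_of_component {e e' : PresheafIso (spectralPresheaf B) (spectralPresheaf A)}
    (hb : e.base = e'.base) (h : ∀ (C : Context A) (a : C.alg),
      (e.toCopresheafIso.component C a : B) = e'.toCopresheafIso.component C a) : e = e' := by
  obtain ⟨γ, ι⟩ := e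
  obtain ⟨γ', ι'⟩ := e'
  obtain rfl : γ = γ' := hb
  congr 1
  ext C l
  refine Context.character_ext (C := C.unop) fun a => ?_
  have h0 : (PresheafIso.toCopresheafIso ⟨γ, ι⟩).component C.unop a =
    (PresheafIso.toCopresheafIso ⟨γ, ι'⟩).component C.unop a := Subtype.ext (h C.unop a)
  have h1 := apply_component_toCopresheafIso ⟨γ, ι⟩ C.unop a l
  have h2 := apply_component_toCopresheafIso ⟨γ, ι'⟩ C.unop a l
  exact h1.symm.trans ((congrArg (fun b : (γ C.unop).alg => (show (γ C.unop).Spec from l) b)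
    h0).trans h2)

end PresheafIso

namespace QuasiJordanIso

variable {Q : QuasiJordanIso A B} {e : PresheafIso (spectralPresheaf B) (spectralPresheaf A)}

/-- Characters separate the elements of `γ(C)`, so the spectral condition says that the map dual to
`ι_C` agrees with `Q`. -/
theorem corrSpectral_iff_corrBohr : Q.CorrSpectral e ↔ Q.CorrBohr e.toCopresheafIso := by
  constructor
  · intro h C a ha
    obtain ⟨hb, hl⟩ := h C a ha
    have : e.toCopresheafIso.component C ⟨a, ha⟩ = ⟨Q.toEquiv a, hb⟩ :=
      Context.spec_ext fun l => (e.apply_component_toCopresheafIso C ⟨a, ha⟩ l).trans (hl l)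
    exact congrArg Subtype.val this
  · intro h C a ha
    have hk := h C a ha
    have hb : (Q.toEquiv a : B) ∈ (e.base C).alg :=
      hk ▸ (e.toCopresheafIso.component C ⟨a, ha⟩).2
    refine ⟨hb, fun l => ?_⟩
    rw [← e.apply_component_toCopresheafIso C ⟨a, ha⟩ l]
    exact congrArg l (Subtype.ext hk)

theorem CorrSpectral.corrOrder (h : Q.CorrSpectral e) : Q.CorrOrder e.base :=
  (corrSpectral_iff_corrBohr.1 h).corrOrder

variable (Q)

/-- The isomorphism of spectral presheaves induced by a quasi-Jordan isomorphism. -/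
def spectralIso : PresheafIso (spectralPresheaf B) (spectralPresheaf A) :=
  PresheafIso.ofHomeo Q.orderIso (fun C => homeoOfStarAlgEquiv (Q.contextEquiv C))
    fun _ _ _ _ _ => rfl

theorem corrSpectral_spectralIso : Q.CorrSpectral Q.spectralIso := fun C a ha =>
  ⟨(Q.corrOrder_orderIso C a).2 ha, fun l =>
    congrArg (fun b : (Q.orderIso C).alg => l b)
      (Subtype.ext (Q.hom.starAlgHom_coe C a ha) : Q.contextEquiv C ⟨a, ha⟩ = ⟨Q.toEquiv a, _⟩)⟩

end QuasiJordanIso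

theorem isBijectiveCorrespondence_spectral :
    IsBijectiveCorrespondence
      (fun (e : PresheafIso (spectralPresheaf B) (spectralPresheaf A)) (Q : QuasiJordanIso A B) =>
        Q.CorrSpectral e) := by
  constructor
  · intro e
    simp only [QuasiJordanIso.corrSpectral_iff_corrBohr]
    exact isBijectiveCorrespondence_bohr.1 e.toCopresheafIso
  · refine fun Q => ⟨Q.spectralIso, Q.corrSpectral_spectralIso, fun e he => ?_⟩
    refine PresheafIso.eq_of_component
      (he.corrOrder.unique Q.corrSpectral_spectralIso.corrOrder) fun C a => ?_
    rw [(QuasiJordanIso.corrSpectral_iff_corrBohr.1 he).coe_component,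
      (QuasiJordanIso.corrSpectral_iff_corrBohr.1 Q.corrSpectral_spectralIso).coe_component]

end Spectral

/-! ### Isomorphisms of partial C*-algebras -/

section Partial

variable {A B : Type u} [CStarAlgebra A] [CStarAlgebra B]

namespace PartialCStar

theorem commute_realPart_imaginaryPart (x : PartialCStar A) :
    Commute (realPart x.1 : A) (imaginaryPart x.1) := by
  obtain ⟨C, hC⟩ := Context.exists_mem x.2
  exact C.2.2 _ (Context.realPart_mem _ hC) _ (Context.imaginaryPart_mem _ hC)

theorem eq_linComb (x : PartialCStar A) : x = linComb 1 Complex.I (ofSelfAdjoint (realPart x.1))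
    (ofSelfAdjoint (imaginaryPart x.1)) x.commute_realPart_imaginaryPart :=
  Subtype.ext (by
    change x.1 = (1 : ℂ) • (realPart x.1 : A) + Complex.I • (imaginaryPart x.1 : A)
    rw [one_smul, realPart_add_I_smul_imaginaryPart])

end PartialCStar

namespace IsPartialHom

theorem isSelfAdjoint {T : PartialCStar A → PartialCStar B} (hT : IsPartialHom T)
    (a : selfAdjoint A) : IsSelfAdjoint (T (PartialCStar.ofSelfAdjoint a)).1 := by
  have h := hT.map_star (PartialCStar.ofSelfAdjoint a)
  have e : star (PartialCStar.ofSelfAdjoint a) = PartialCStar.ofSelfAdjoint a :=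
    Subtype.ext a.2
  rw [e] at h
  exact (congrArg (fun z : PartialCStar B => z.1) h).symm

/-- The restriction of a morphism of partial C*-algebras to the self-adjoint elements. -/
def restrict {T : PartialCStar A → PartialCStar B} (hT : IsPartialHom T) (a : selfAdjoint A) :
    selfAdjoint B := ⟨(T (PartialCStar.ofSelfAdjoint a)).1, hT.isSelfAdjoint a⟩

/-- Multiplicativity applied to both orders of a commuting product shows that the images commute, so
Jordan and ordinary products agree on both sides. -/
theorem isQuasiJordanHom_restrict {T : PartialCStar A → PartialCStar B} (hT : IsPartialHom T) :
    IsQuasiJordanHom hT.restrict := by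
  refine ⟨?_, fun C a b ha hb => ?_, fun C r a ha => ?_, fun C a b ha hb => ?_⟩
  · exact Subtype.ext (congrArg (fun z : PartialCStar B => z.1) hT.map_one)
  · have hc : Commute (a : A) b := C.2.2 _ ha _ hb
    have h := hT.map_linComb 1 1 (.ofSelfAdjoint a) (.ofSelfAdjoint b) hc
    have e : PartialCStar.linComb 1 1 (.ofSelfAdjoint a) (.ofSelfAdjoint b) hc =
        .ofSelfAdjoint (a + b) := Subtype.ext (by
      change (1 : ℂ) • (a : A) + (1 : ℂ) • (b : A) = a + b
      rw [one_smul, one_smul])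
    rw [e, one_smul, one_smul] at h
    exact Subtype.ext h
  · have h := hT.map_linComb r 0 (.ofSelfAdjoint a) (.ofSelfAdjoint a) (.refl _)
    have e : PartialCStar.linComb r 0 (.ofSelfAdjoint a) (.ofSelfAdjoint a) (.refl _) =
        .ofSelfAdjoint (r • a) := Subtype.ext (by
      change (r : ℂ) • (a : A) + (0 : ℂ) • (a : A) = ((r • a : selfAdjoint A) : A)
      rw [zero_smul, add_zero, Complex.coe_smul, selfAdjoint.val_smul])
    rw [e, zero_smul, add_zero, Complex.coe_smul] at h
    exact Subtype.ext h
  · have hc : Commute (a : A) b := C.2.2 _ ha _ hb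
    have h := hT.map_mul (.ofSelfAdjoint a) (.ofSelfAdjoint b) hc
    have h' := hT.map_mul (.ofSelfAdjoint b) (.ofSelfAdjoint a) hc.symm
    have e : PartialCStar.mul (.ofSelfAdjoint a) (.ofSelfAdjoint b) hc =
        .ofSelfAdjoint (jordanMul a b) := Subtype.ext (coe_jordanMul_of_commute hc).symm
    have e' : PartialCStar.mul (.ofSelfAdjoint b) (.ofSelfAdjoint a) hc.symm =
        .ofSelfAdjoint (jordanMul a b) :=
      Subtype.ext (hc.symm.eq.trans (coe_jordanMul_of_commute hc).symm)
    rw [e] at h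
    rw [e'] at h'
    have hc' : Commute (hT.restrict a : B) (hT.restrict b) := h.symm.trans h'
    exact Subtype.ext (h.trans (coe_jordanMul_of_commute hc').symm)

end IsPartialHom

namespace PartialIso

theorem ext_apply {S T : PartialIso A B} (h : ∀ x, S.toEquiv x = T.toEquiv x) : S = T := by
  obtain ⟨e, _, _⟩ := S
  obtain ⟨f, _, _⟩ := T
  obtain rfl : e = f := Equiv.ext h
  rfl

/-- The restriction of an isomorphism of partial C*-algebras to the self-adjoint elements. -/
def toQuasiJordanIso (T : PartialIso A B) : QuasiJordanIso A B where
  toEquiv :=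
    { toFun := T.hom.restrict
      invFun := T.inv.restrict
      left_inv := fun a => Subtype.ext (congrArg (fun z : PartialCStar A => z.1)
        (T.toEquiv.symm_apply_apply (.ofSelfAdjoint a)))
      right_inv := fun a => Subtype.ext (congrArg (fun z : PartialCStar B => z.1)
        (T.toEquiv.apply_symm_apply (.ofSelfAdjoint a))) }
  hom := T.hom.isQuasiJordanHom_restrict
  inv := T.inv.isQuasiJordanHom_restrict

end PartialIso

namespace IsQuasiJordanHom

variable {Q : selfAdjoint A → selfAdjoint B} (hQ : IsQuasiJordanHom Q)

/-- The extension of a quasi-Jordan homomorphism to the normal elements. -/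
def extendNormal (x : PartialCStar A) : PartialCStar B :=
  ⟨extend Q x.1, by
    obtain ⟨C, hC⟩ := Context.exists_mem x.2
    refine ⟨?_⟩
    have := (Commute.all (star (⟨x.1, hC⟩ : C.alg)) ⟨x.1, hC⟩).map (hQ.starAlgHom C)
    rwa [map_star] at this⟩

/-- Commuting normal elements share a context, on which the extension is a star-homomorphism. -/
theorem isPartialHom_extendNormal : IsPartialHom hQ.extendNormal := by
  refine ⟨?_, fun x => ?_, fun α β x y h => ?_, fun x y h => ?_⟩
  · obtain ⟨C, hC⟩ := Context.exists_mem (A := A) (x := 1) inferInstance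
    exact Subtype.ext (_root_.map_one (hQ.starAlgHom C))
  · obtain ⟨C, hC⟩ := Context.exists_mem x.2
    exact Subtype.ext (hQ.extend_star C hC)
  · obtain ⟨C, hx, hy⟩ := Context.exists_mem_of_commute x.2 y.2 h
    have := _root_.map_add (hQ.starAlgHom C) (α • (⟨x.1, hx⟩ : C.alg)) (β • (⟨y.1, hy⟩ : C.alg))
    rwa [_root_.map_smul, _root_.map_smul] at this
  · obtain ⟨C, hx, hy⟩ := Context.exists_mem_of_commute x.2 y.2 h
    exact hQ.extend_mul C hx hy

end IsQuasiJordanHom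

namespace QuasiJordanIso

/-- The extension of a quasi-Jordan isomorphism to the normal elements. -/
def partialIso (Q : QuasiJordanIso A B) : PartialIso A B where
  toEquiv :=
    { toFun := Q.hom.extendNormal
      invFun := Q.inv.extendNormal
      left_inv := fun x => Subtype.ext
        (IsQuasiJordanHom.extend_extend Q.toEquiv.symm_apply_apply x.1)
      right_inv := fun x => Subtype.ext
        (IsQuasiJordanHom.extend_extend Q.toEquiv.apply_symm_apply x.1) }
  hom := Q.hom.isPartialHom_extendNormal
  inv := Q.inv.isPartialHom_extendNormal

theorem corrPartial_partialIso (Q : QuasiJordanIso A B) : Q.CorrPartial Q.partialIso := fun a =>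
  Subtype.ext (Q.hom.extend_coe a)

end QuasiJordanIso

theorem isBijectiveCorrespondence_partial :
    IsBijectiveCorrespondence
      (fun (T : PartialIso A B) (Q : QuasiJordanIso A B) => Q.CorrPartial T) := by
  constructor
  · refine fun T => ⟨T.toQuasiJordanIso, fun a => rfl, fun Q hQ =>
      QuasiJordanIso.ext_apply fun a => ?_⟩
    exact Subtype.ext (congrArg (fun z : PartialCStar B => z.1) (hQ a).symm)
  · refine fun Q => ⟨Q.partialIso, Q.corrPartial_partialIso, fun T hT =>
      PartialIso.ext_apply fun x => ?_⟩
    have key : ∀ a, T.toEquiv (.ofSelfAdjoint a) = Q.partialIso.toEquiv (.ofSelfAdjoint a) :=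
      fun a => (hT a).trans (Q.corrPartial_partialIso a).symm
    rw [x.eq_linComb]
    refine Subtype.ext ((T.hom.map_linComb _ _ _ _ _).trans
      (Eq.trans ?_ (Q.partialIso.hom.map_linComb _ _ _ _ _).symm))
    rw [key, key]

end Partial

end

theorem mainTheorem2 {A B : Type u} [CStarAlgebra A] [CStarAlgebra B] [Nontrivial A] [Nontrivial B]
    (hA₁ : IsEmpty (A ≃⋆ₐ[ℂ] (ℂ × ℂ)))
    (hA₂ : IsEmpty (A ≃⋆ₐ[ℂ] (EuclideanSpace ℂ (Fin 2) →L[ℂ] EuclideanSpace ℂ (Fin 2))))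
    (hB₁ : IsEmpty (B ≃⋆ₐ[ℂ] (ℂ × ℂ)))
    (hB₂ : IsEmpty (B ≃⋆ₐ[ℂ] (EuclideanSpace ℂ (Fin 2) →L[ℂ] EuclideanSpace ℂ (Fin 2)))) :
    IsBijectiveCorrespondence
      (fun (e : PresheafIso (spectralPresheaf B) (spectralPresheaf A)) (Q : QuasiJordanIso A B) =>
        Q.CorrSpectral e) ∧
    IsBijectiveCorrespondence
      (fun (T : PartialIso A B) (Q : QuasiJordanIso A B) => Q.CorrPartial T) ∧
    IsBijectiveCorrespondence
      (fun (k : CopresheafIso (bohrification A) (bohrification B)) (Q : QuasiJordanIso A B) =>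
        Q.CorrBohr k) ∧
    IsBijectiveCorrespondence
      (fun (γ : Context A ≃o Context B) (Q : QuasiJordanIso A B) => Q.CorrOrder γ) ∧
    (∀ (Q : QuasiJordanIso A B) (e : PresheafIso (spectralPresheaf B) (spectralPresheaf A)),
      Q.CorrSpectral e → Q.CorrOrder e.base) ∧
    (∀ (Q : QuasiJordanIso A B) (k : CopresheafIso (bohrification A) (bohrification B)),
      Q.CorrBohr k → Q.CorrOrder k.base) ∧
    (∀ γ : Context A ≃o Context B,
      (∃! e : PresheafIso (spectralPresheaf B) (spectralPresheaf A), e.base = γ) ∧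
      ∃! k : CopresheafIso (bohrification A) (bohrification B), k.base = γ) := by
  have hO := isBijectiveCorrespondence_order (B := B) hA₁ hA₂
  have hS := isBijectiveCorrespondence_spectral (A := A) (B := B)
  have hK := isBijectiveCorrespondence_bohr (A := A) (B := B)
  refine ⟨hS, isBijectiveCorrespondence_partial, hK, hO, fun Q e h => h.corrOrder,
    fun Q k h => h.corrOrder, fun γ => ?_⟩
  -- Any isomorphism over `γ` corresponds to some `R` whose order-isomorphism is `γ`. Hence `R = Q`,
  -- and `Q` has only one partner of each kind.
  obtain ⟨Q, hQ, huniq⟩ := hO.1 γ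
  constructor
  · refine ⟨Q.spectralIso, Q.corrSpectral_spectralIso.corrOrder.unique hQ, fun e he => ?_⟩
    obtain ⟨R, hR, -⟩ := hS.1 e
    obtain rfl : R = Q := huniq R (he ▸ QuasiJordanIso.CorrSpectral.corrOrder hR)
    exact (hS.2 R).unique hR R.corrSpectral_spectralIso
  · refine ⟨Q.bohrIso, Q.corrBohr_bohrIso.corrOrder.unique hQ, fun k hk => ?_⟩
    obtain ⟨R, hR, -⟩ := hK.1 k
    obtain rfl : R = Q := huniq R (hk ▸ QuasiJordanIso.CorrBohr.corrOrder hR)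
    exact (hK.2 R).unique hR R.corrBohr_bohrIso
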